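/- Let $\mathcal X$ be a separable real Hilbert space, $n\ge 0$, and let $\kappa:\mathcal X\times\mathcal X\to\mathcal L(\mathcal X)$ be an operator-valued kernel (with $(f,g)\mapsto\kappa(f,g)v$ measurable for every $v$). Let $F=(f^{(1)},\dots,f^{(n+1)})$ and $U=(u^{(1)},\dots,u^{(n+1)})$ be random elements of $\mathcal X^{n+1}$ such that, conditionally on $F$, $U$ is a centred jointly Gaussian $\kappa$-random variable: for almost every value of $F$, the conditional law of $U$ is Gaussian on $\mathcal X^{n+1}$ with $\mathbb E[\langle v,u^{(i)}\rangle\langle w,u^{(j)}\rangle]=\langle v,\kappa(f^{(i)},f^{(j)})w\rangle$ and $\langle v,u^{(i)}\rangle\sim\mathcal N(0,\langle v,\kappa(f^{(i)},f^{(i)})v\rangle)$ for all $v,w\in\mathcal X$ and all $i,j$. Put $\hat U=(u^{(1)},\dots,u^{(n)})$, $\hat{\mathbb K}=(\kappa(f^{(i)},f^{(j)}))_{i,j\le n}\in\mathcal L(\mathcal X^n)$ and $\nu^T\hat U=\sum_{i\le n}\kappa(f^{(n+1)},f^{(i)})u^{(i)}$. Consider the continuum transformer started at the context $Z_0$ with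 tokens $(f^{(i)},u^{(i)})$ for $i\le n$ and $(f^{(n+1)},0)$, with layers $$Z_{\ell+1}=Z_\ell+\Big(\widetilde H(\mathcal W_{q}X_\ell,\mathcal W_{k}X_\ell)\,\mathcal M\,(\mathcal W_{v}Z_\ell)^T\Big)^T,\qquad \ell=0,\dots,m,$$ where $X_\ell$ is the first row of $Z_\ell$, $\mathcal M=\mathrm{diag}(I,\dots,I,0)$, $[\widetilde H(A,B)]_{i,j}=\kappa(a^{(i)},b^{(j)})$, $\mathcal W_q=\mathcal W_k=I$ and $\mathcal W_v=\begin{pmatrix}0&0\\0&-\delta I\end{pmatrix}$ with a constant step $\delta>0$. Its prediction of $u^{(n+1)}$ is $T_m=-[Z_{m+1}]_{2,n+1}$, and the in-context loss of a predictor $g$ that is a function of $F$ and $\hat U$ is $\mathbb E\|u^{(n+1)}-g(F,\hat U)\|^2$. A linear predictor is a measurable map $\mathcal X^n\to\mathcal X$ that is a bounded linear operator or a limit of bounded linear operators in $L^2$ of the (conditional) law of $\hat U$; the Best Linear Unbiased Predictor (BLUP) minimizes the conditional mean squared error among the linear predictors that are unbiased, and a Bayes-optimal predictor minimizes it among all measurable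 maps $\mathcal X^n\to\mathcal X$. Then: 1. For almost every value of $F$ and every $\delta>0$ with $\|I-\delta\hat{\mathbb K}\|<1$: $\hat{\mathbb K}$ is boundedly invertible with $\hat{\mathbb K}^{-1}=\sum_{k\ge0}\delta(I-\delta\hat{\mathbb K})^k$ (in operator norm); for every value of $\hat U$ in $\mathcal X^n$, $T_m\to\nu^T\hat{\mathbb K}^{-1}\hat U$ as $m\to\infty$; and $\nu^T\hat{\mathbb K}^{-1}\hat U$ is the BLUP of $u^{(n+1)}$ from $\hat U$ and also the Bayes-optimal predictor, both unique almost surely. 2. For almost every value of $F$ and every $\delta>0$ with $\delta\|\hat{\mathbb K}\|<2$ ($\hat{\mathbb K}$ need not be boundedly invertible, as is the case when $n\ge1$ and $\mathcal X$ is infinite-dimensional): the BLUP and the Bayes-optimal predictor exist, are almost surely unique and coincide, and $T_m$ converges to them in $L^2$ of the conditional law. 3. If $\delta>0$ satisfies $\|I-\delta\hat{\mathbb K}\|<1$ almost surely, then almost surely $T_m\to\nu^T\hat{\mathbb K}^{-1}\hat U$, and this limit minimizes the in-context loss (expectation over $F$ and $U$) among all measurable predictors $g(F,\hat U)$. 4.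 If $\delta>0$ satisfies $\delta\|\hat{\mathbb K}\|<2$ almost surely and $\mathbb E\|u^{(n+1)}\|^2<\infty$, then the in-context loss of $T_m$ converges, as $m\to\infty$, to the infimum of the in-context loss over all measurable predictors $g(F,\hat U)$. -/

import Mathlib

open MeasureTheory ProbabilityTheory Filter Topology
open scoped ENNReal NNReal InnerProductSpace

noncomputable section

namespace ContinuumICL

variable {X : Type*} [NormedAddCommGroup X] [InnerProductSpace ℝ X] {n : ℕ}

/-! ### The continuum transformer

A token is a pair `(f, u) : X × X`; a context is a family of `n + 1` tokens. -/

/-- The mask: the block operator `diag (I, …, I, 0)`, which erases the last token. -/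
def mask (V : Fin (n + 1) → X × X) : Fin (n + 1) → X × X :=
  fun j => if j = Fin.last n then 0 else V j

/-- One generalized attention layer with residual connection,
`Z ↦ Z + (H (W_q F, W_k F) · M (W_v Z)ᵀ)ᵀ`, where `F` is the row of first components of `Z`.
The attention weights `H` are bounded operators on `X`; they act on both components of a token. -/
def attentionLayer {Q K : Type*} [NormedAddCommGroup Q] [NormedSpace ℝ Q]
    [NormedAddCommGroup K] [NormedSpace ℝ K]
    (H : (Fin (n + 1) → Q) → (Fin (n + 1) → K) →
      Matrix (Fin (n + 1)) (Fin (n + 1)) (X →L[ℝ] X))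
    (Wq : (Fin (n + 1) → X) →L[ℝ] (Fin (n + 1) → Q))
    (Wk : (Fin (n + 1) → X) →L[ℝ] (Fin (n + 1) → K))
    (Wv : (Fin (n + 1) → X × X) →L[ℝ] (Fin (n + 1) → X × X))
    (Z : Fin (n + 1) → X × X) : Fin (n + 1) → X × X :=
  fun i => Z i + ∑ j,
    ((H (Wq fun t => (Z t).1) (Wk fun t => (Z t).1) i j).prodMap
      (H (Wq fun t => (Z t).1) (Wk fun t => (Z t).1) i j)) (mask (Wv Z) j)

/-- The nonlinearity that matches `κ`: `[H (A, B)]_{i,j} = κ (a_i, b_j)`. -/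
def kernelActivation (κ : X → X → X →L[ℝ] X) (A B : Fin (n + 1) → X) :
    Matrix (Fin (n + 1)) (Fin (n + 1)) (X →L[ℝ] X) :=
  Matrix.of fun i j => κ (A i) (B j)

/-- The value operator `(0, 0; 0, -r I)`, applied to each token. -/
def valueOp (r : ℝ) : (Fin (n + 1) → X × X) →L[ℝ] (Fin (n + 1) → X × X) :=
  ContinuousLinearMap.pi fun i =>
    ((0 : X →L[ℝ] X).prodMap (-r • ContinuousLinearMap.id ℝ X)).comp
      (ContinuousLinearMap.proj i)

/-- The state `Z_ℓ` of the transformer that implements operator gradient descent with steps `r`: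
`W_q = W_k = I`, `W_v = (0, 0; 0, -r_ℓ I)` and the nonlinearity given by `κ`. -/
def state (κ : X → X → X →L[ℝ] X) (r : ℕ → ℝ) (Z₀ : Fin (n + 1) → X × X) :
    ℕ → Fin (n + 1) → X × X
  | 0 => Z₀
  | ℓ + 1 => attentionLayer (kernelActivation κ) (ContinuousLinearMap.id ℝ _)
      (ContinuousLinearMap.id ℝ _) (valueOp (r ℓ)) (state κ r Z₀ ℓ)

/-- The input context `Z_0`: inputs `f_1, …, f_{n+1}`, outputs `u_1, …, u_n, 0`. -/
def prompt (f : Fin (n + 1) → X) (u : Fin n → X) : Fin (n + 1) → X × X :=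
  fun i => (f i, (Fin.snoc u 0 : Fin (n + 1) → X) i)

/-- The prediction of `u_{n+1}` by the transformer with layers `0, …, m`: the negative of the
output entry of the last token of `Z_{m+1}`. -/
def transformerPrediction (κ : X → X → X →L[ℝ] X) (r : ℕ → ℝ) (m : ℕ)
    (f : Fin (n + 1) → X) (u : Fin n → X) : X :=
  -(state κ r (prompt f u) (m + 1) (Fin.last n)).2

/-! ### The kriging predictor -/

/-- The block operator `(κ (f_i, f_j))_{i,j ≤ n}` on the Hilbert space `X ^ n`
(the top left `n × n` block of the operator for all `n + 1` inputs). -/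
def gramOp (κ : X → X → X →L[ℝ] X) (f : Fin (n + 1) → X) :
    PiLp 2 (fun _ : Fin n => X) →L[ℝ] PiLp 2 (fun _ : Fin n => X) :=
  ((PiLp.continuousLinearEquiv 2 ℝ fun _ : Fin n => X).symm.toContinuousLinearMap.comp
    (ContinuousLinearMap.pi fun i => ∑ j,
      (κ (f i.castSucc) (f j.castSucc)).comp (ContinuousLinearMap.proj j))).comp
    (PiLp.continuousLinearEquiv 2 ℝ fun _ : Fin n => X).toContinuousLinearMap

/-- The operator `νᵀ : X ^ n → X`, `u ↦ ∑ i, κ (f_{n+1}, f_i) u_i`. -/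
def crossOp (κ : X → X → X →L[ℝ] X) (f : Fin (n + 1) → X) :
    PiLp 2 (fun _ : Fin n => X) →L[ℝ] X :=
  (∑ i : Fin n, (κ (f (Fin.last n)) (f i.castSucc)).comp (ContinuousLinearMap.proj i)).comp
    (PiLp.continuousLinearEquiv 2 ℝ fun _ : Fin n => X).toContinuousLinearMap

/-- The predictor `u ↦ νᵀ K⁻¹ u`, for an invertible Gram operator `K`. -/
def krigingPredictor (κ : X → X → X →L[ℝ] X) (f : Fin (n + 1) → X) (u : Fin n → X) : X :=
  crossOp κ f (Ring.inverse (gramOp κ f) (WithLp.toLp 2 u))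

/-! ### Gaussian laws and optimal predictors -/

variable [MeasurableSpace X]

/-- The law `μ` on `X ^ N` is the centred jointly Gaussian law `𝒩 (0, (κ (f_i, f_j))_{i,j})`. -/
structure IsKappaGaussian {N : ℕ} (κ : X → X → X →L[ℝ] X) (f : Fin N → X)
    (μ : Measure (Fin N → X)) : Prop where
  jointly_gaussian : IsGaussian μ
  covariance : ∀ (i j : Fin N) (v w : X),
    ∫ u, ⟪v, u i⟫_ℝ * ⟪w, u j⟫_ℝ ∂μ = ⟪v, κ (f i) (f j) w⟫_ℝ
  marginal : ∀ (i : Fin N) (v : X),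
    μ.map (fun u => ⟪v, u i⟫_ℝ) = gaussianReal 0 (Real.toNNReal ⟪v, κ (f i) (f i) v⟫_ℝ)

/-- The observed part `(u_1, …, u_n)` of `(u_1, …, u_{n+1})`. -/
def observed (u : Fin (n + 1) → X) : Fin n → X := fun i => u i.castSucc

/-- The mean squared error `E ‖u_{n+1} - g (u_1, …, u_n)‖²` for `(u_1, …, u_{n+1}) ∼ μ`. -/
def meanSquareError (μ : Measure (Fin (n + 1) → X)) (g : (Fin n → X) → X) : ℝ≥0∞ :=
  ∫⁻ u, ‖u (Fin.last n) - g (observed u)‖ₑ ^ 2 ∂μ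

/-- The squared `L²(μ)`-distance of two predictors. -/
def predictorDist (μ : Measure (Fin (n + 1) → X)) (g h : (Fin n → X) → X) : ℝ≥0∞ :=
  ∫⁻ u, ‖g (observed u) - h (observed u)‖ₑ ^ 2 ∂μ

/-- A linear predictor: a bounded linear operator `X ^ n → X`, or an `L²`-limit of such
operators (the best linear predictor need not be bounded if `X` has infinite dimension). -/
def IsLinearPredictor (μ : Measure (Fin (n + 1) → X)) (g : (Fin n → X) → X) : Prop :=
  Measurable g ∧ ∃ A : ℕ → (Fin n → X) →L[ℝ] X,
    Tendsto (fun k => predictorDist μ g (A k)) atTop (𝓝 0)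

/-- `E g (u_1, …, u_n) = E u_{n+1}`. -/
def IsUnbiased (μ : Measure (Fin (n + 1) → X)) (g : (Fin n → X) → X) : Prop :=
  Integrable (fun u => g (observed u)) μ ∧ Integrable (fun u => u (Fin.last n)) μ ∧
    ∫ u, g (observed u) ∂μ = ∫ u, u (Fin.last n) ∂μ

/-- `g` is a best linear unbiased predictor of `u_{n+1}` from `u_1, …, u_n`. -/
def IsBLUP (μ : Measure (Fin (n + 1) → X)) (g : (Fin n → X) → X) : Prop :=
  IsLinearPredictor μ g ∧ IsUnbiased μ g ∧
    ∀ h, IsLinearPredictor μ h → IsUnbiased μ h → meanSquareError μ g ≤ meanSquareError μ h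

/-- `g` minimizes the mean squared error among all measurable predictors. -/
def IsBayesOptimal (μ : Measure (Fin (n + 1) → X)) (g : (Fin n → X) → X) : Prop :=
  Measurable g ∧ ∀ h, Measurable h → meanSquareError μ g ≤ meanSquareError μ h

/-- `g` is the BLUP and the Bayes optimal predictor, both being unique almost surely. -/
def IsTheBLUPAndBayes (μ : Measure (Fin (n + 1) → X)) (g : (Fin n → X) → X) : Prop :=
  (IsBLUP μ g ∧ ∀ h, IsBLUP μ h → ∀ᵐ u ∂μ, h (observed u) = g (observed u)) ∧
    (IsBayesOptimal μ g ∧ ∀ h, IsBayesOptimal μ h → ∀ᵐ u ∂μ, h (observed u) = g (observed u))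

/-- The in-context loss `E ‖u_{n+1} - g (f_1, …, f_{n+1}; u_1, …, u_n)‖²` of a predictor that
sees the whole context; for the transformer this is `E ‖[Z_{m+1}]_{2,n+1} + u_{n+1}‖²`. -/
def inContextLoss {Ω : Type*} [MeasurableSpace Ω] (P : Measure Ω) (F U : Ω → Fin (n + 1) → X)
    (g : (Fin (n + 1) → X) → (Fin n → X) → X) : ℝ≥0∞ :=
  ∫⁻ ω, ‖U ω (Fin.last n) - g (F ω) (observed (U ω))‖ₑ ^ 2 ∂P

end ContinuumICL

end

open MeasureTheory ProbabilityTheory Filter Topology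
open scoped ENNReal NNReal InnerProductSpace

noncomputable section

/-! Fix the inputs, so that `U` has a centred Gaussian law `μ`. Let `J` send `w` in `X ^ n` to the
scalar random variable `⟪w, (u_1, …, u_n)⟫` in `L²(μ)`, and let `y_v = ⟪v, u_{n+1}⟫`. The covariance
hypothesis says exactly that `J† J` is the Gram operator and that `J† y_v` is the adjoint of `νᵀ`
applied to `v`. Unrolled, the transformer applies `νᵀ ∑ δ (1 - δ K)ᵏ`, so the component along `v` of
its error is `(1 - δ J J†) ^ (m + 1) y_v` (`featureMap_errorOp`): each layer is a Landweber step for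
the regression of `u_{n+1}` on the observations.

If `δ ‖K‖ = δ ‖J‖² < 2`, these residuals converge in norm to the part of `y_v` orthogonal to the
range of `J`, with no inverse of `K` involved. Summing over a Hilbert basis, with the finite second
moment of `u_{n+1}` as dominating bound, gives convergence of the vector-valued predictions in `L²`
to a measurable function `g` of the observations.

The limiting error is centred and uncorrelated with the observations. Being an `L²`-limit of linear
functions of a Gaussian vector, it is therefore independent of them
(`indepFun_of_tendsto_of_uncorrelated`). Pythagoras then yields `MSE(g') = MSE(g) + dist(g, g')` for
every measurable `g'` (`meanSquareError_eq_add`), from which BLUP, Bayes optimality and both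
uniqueness claims follow. When `‖1 - δ K‖ < 1`, the Neumann series identifies `g` with the kriging
predictor. The statements on the in-context loss come from disintegration over the inputs. -/

namespace ContinuumICL

/-! ### Landweber iteration with an operator whose range need not be closed. -/

section Landweber

variable {E H : Type*} [NormedAddCommGroup E] [InnerProductSpace ℝ E] [CompleteSpace E]
  [NormedAddCommGroup H] [InnerProductSpace ℝ H] [CompleteSpace H]

open ContinuousLinearMap in
/-- The residual operator `1 - δ J J†` of the Landweber iteration. -/
def residualOp (J : E →L[ℝ] H) (δ : ℝ) : H →L[ℝ] H := 1 - δ • (J ∘L adjoint J)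

variable {J : E →L[ℝ] H} {δ : ℝ}

open ContinuousLinearMap

lemma residualOp_apply (y : H) : residualOp J δ y = y - δ • J (adjoint J y) := by
  simp [residualOp]

/-- In the expanded square, the cross term is `-2 δ ‖J† y‖²` and the quadratic term is at most `δ²
‖J‖² ‖J† y‖²`. The gain is positive precisely in the step range `δ ‖J‖² < 2`. -/
lemma norm_residualOp_sq_le (y : H) :
    ‖residualOp J δ y‖ ^ 2 ≤ ‖y‖ ^ 2 - δ * (2 - δ * ‖J‖ ^ 2) * ‖adjoint J y‖ ^ 2 := by
  have h1 : ⟪y, J (adjoint J y)⟫_ℝ = ‖adjoint J y‖ ^ 2 := by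
    rw [← adjoint_inner_left, real_inner_self_eq_norm_sq]
  have h2 : ‖J (adjoint J y)‖ ^ 2 ≤ ‖J‖ ^ 2 * ‖adjoint J y‖ ^ 2 := by
    rw [← mul_pow]
    exact pow_le_pow_left₀ (norm_nonneg _) (J.le_opNorm _) 2
  rw [residualOp_apply, norm_sub_sq_real, inner_smul_right, h1, norm_smul, mul_pow,
    Real.norm_eq_abs, sq_abs]
  nlinarith [sq_nonneg δ, mul_le_mul_of_nonneg_left h2 (sq_nonneg δ)]

lemma norm_residualOp_le (hδ : 0 < δ) (hJ : δ * ‖J‖ ^ 2 < 2) (y : H) :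
    ‖residualOp J δ y‖ ≤ ‖y‖ := by
  have h := norm_residualOp_sq_le (J := J) (δ := δ) y
  have : 0 ≤ δ * (2 - δ * ‖J‖ ^ 2) * ‖adjoint J y‖ ^ 2 :=
    mul_nonneg (mul_nonneg hδ.le (by linarith)) (sq_nonneg _)
  exact le_of_sq_le_sq (by linarith) (norm_nonneg _)

lemma norm_residualOp_pow_le (hδ : 0 < δ) (hJ : δ * ‖J‖ ^ 2 < 2) (k : ℕ) (y : H) :
    ‖(residualOp J δ ^ k) y‖ ≤ ‖y‖ := by
  induction k with
  | zero => simp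
  | succ k ih =>
    rw [pow_succ', mul_apply_eq_comp]
    exact (norm_residualOp_le hδ hJ _).trans ih

/-- The decrease of the squared residual telescopes, so the squared gradients `‖J† r_k‖²` are
summable. -/
lemma tendsto_adjoint_residualOp_pow (hδ : 0 < δ) (hJ : δ * ‖J‖ ^ 2 < 2) (y : H) :
    Tendsto (fun k => adjoint J ((residualOp J δ ^ k) y)) atTop (𝓝 0) := by
  set c := δ * (2 - δ * ‖J‖ ^ 2) with hc
  have hc0 : 0 < c := mul_pos hδ (by linarith)
  have hsum : Summable fun k => c * ‖adjoint J ((residualOp J δ ^ k) y)‖ ^ 2 := by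
    refine summable_of_sum_range_le (c := ‖y‖ ^ 2) (fun k => by positivity) fun m => ?_
    have : ∑ k ∈ Finset.range m, c * ‖adjoint J ((residualOp J δ ^ k) y)‖ ^ 2
        ≤ ‖y‖ ^ 2 - ‖(residualOp J δ ^ m) y‖ ^ 2 := by
      induction m with
      | zero => simp
      | succ m ih =>
        rw [Finset.sum_range_succ, pow_succ' (residualOp J δ), mul_apply_eq_comp]
        have := norm_residualOp_sq_le (J := J) (δ := δ) ((residualOp J δ ^ m) y)
        linarith
    nlinarith [sq_nonneg ‖(residualOp J δ ^ m) y‖]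
  have h := (hsum.tendsto_atTop_zero.const_mul c⁻¹).sqrt
  rw [tendsto_zero_iff_norm_tendsto_zero]
  simpa [← mul_assoc, hc0.ne', Real.sqrt_sq (norm_nonneg _)] using h

lemma residualOp_pow_comp (k : ℕ) (w : E) :
    (residualOp J δ ^ k) (J w) = J (((1 - δ • (adjoint J ∘L J)) ^ k) w) := by
  induction k with
  | zero => simp
  | succ k ih => rw [pow_succ', mul_apply_eq_comp, ih, pow_succ', mul_apply_eq_comp,
      residualOp_apply]; simp

/-- On the range, `J J†` commutes with the iteration and the gradient tends to zero; the uniform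
bound `‖R ^ k‖ ≤ 1` extends this to the closure. -/
lemma tendsto_residualOp_pow_of_mem_closure (hδ : 0 < δ) (hJ : δ * ‖J‖ ^ 2 < 2) {y : H}
    (hy : y ∈ closure (Set.range (J ∘L adjoint J))) :
    Tendsto (fun k => (residualOp J δ ^ k) y) atTop (𝓝 0) := by
  rw [Metric.tendsto_atTop]
  intro ε hε
  obtain ⟨-, ⟨x, rfl⟩, hx⟩ := Metric.mem_closure_iff.1 hy (ε / 2) (half_pos hε)
  have h0 : Tendsto (fun k => (residualOp J δ ^ k) ((J ∘L adjoint J) x)) atTop (𝓝 0) := by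
    have hcomm (k : ℕ) : Commute (residualOp J δ ^ k) (J ∘L adjoint J) := by
      refine Commute.pow_left ?_ k
      exact (Commute.one_left _).sub_left ((Commute.refl (J ∘L adjoint J)).smul_left δ)
    have h1 := (J.continuous.tendsto 0).comp (tendsto_adjoint_residualOp_pow hδ hJ x)
    rw [map_zero] at h1
    refine h1.congr fun k => ?_
    have := congrArg (fun T : H →L[ℝ] H => T x) (hcomm k).eq
    simpa using this.symm
  obtain ⟨N, hN⟩ := Metric.tendsto_atTop.1 h0 (ε / 2) (half_pos hε)
  refine ⟨N, fun k hk => ?_⟩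
  have h2 := norm_residualOp_pow_le hδ hJ k (y - (J ∘L adjoint J) x)
  rw [map_sub] at h2
  have h3 := hN k hk
  rw [dist_zero_right] at h3 ⊢
  rw [dist_eq_norm] at hx
  have := norm_le_norm_sub_add ((residualOp J δ ^ k) y) ((residualOp J δ ^ k) ((J ∘L adjoint J) x))
  linarith

/-- The residuals of the Landweber iteration converge to the component orthogonal to the range. -/
lemma exists_tendsto_residualOp_pow (hδ : 0 < δ) (hJ : δ * ‖J‖ ^ 2 < 2) (y : H) :
    ∃ z, adjoint J z = 0 ∧ Tendsto (fun k => (residualOp J δ ^ k) y) atTop (𝓝 z) ∧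
      ∀ k, ‖(residualOp J δ ^ k) y - z‖ ≤ ‖y‖ := by
  set D := J ∘L adjoint J with hD
  have hDsa : adjoint D = D := by rw [hD, adjoint_comp, adjoint_adjoint]
  let S : Submodule ℝ H := D.range.topologicalClosure
  have hz : y - S.starProjection y ∈ Sᗮ := S.sub_starProjection_mem_orthogonal y
  set z := y - S.starProjection y with hzdef
  -- `z` is orthogonal to the range of the self-adjoint `D = J J†`, hence `D z = 0`, and `⟪z, D z⟫ =
  -- ‖J† z‖²`.
  have hJz : adjoint J z = 0 := by
    rw [Submodule.orthogonal_closure, orthogonal_range, hDsa] at hz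
    have h1 : D z = 0 := hz
    have h2 : ⟪z, D z⟫_ℝ = ‖adjoint J z‖ ^ 2 := by
      rw [hD, comp_apply, ← adjoint_inner_left, real_inner_self_eq_norm_sq]
    rw [h1, inner_zero_right] at h2
    simpa using h2.symm
  have hfix (k : ℕ) : (residualOp J δ ^ k) z = z := by
    induction k with
    | zero => simp
    | succ k ih => rw [pow_succ', mul_apply_eq_comp, ih, residualOp_apply, hJz]; simp
  have hsub (k : ℕ) : (residualOp J δ ^ k) y - z = (residualOp J δ ^ k) (S.starProjection y) := by
    have : S.starProjection y = y - z := by simp [hzdef]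
    rw [this, map_sub, hfix]
  refine ⟨z, hJz, ?_, fun k => ?_⟩
  · rw [tendsto_iff_norm_sub_tendsto_zero]
    simp_rw [hsub]
    refine tendsto_zero_iff_norm_tendsto_zero.1 (tendsto_residualOp_pow_of_mem_closure hδ hJ ?_)
    have : S.starProjection y ∈ S := S.starProjection_apply_mem y
    exact this
  · rw [hsub]
    exact (norm_residualOp_pow_le hδ hJ k _).trans (S.norm_starProjection_apply_le y)

/-- The Landweber iterate, in terms of its residual. -/
lemma sum_residualOp_pow_comp_adjoint (m : ℕ) (y : H) :
    J ((∑ k ∈ Finset.range m, δ • (1 - δ • (adjoint J ∘L J)) ^ k) (adjoint J y)) =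
      y - (residualOp J δ ^ m) y := by
  induction m with
  | zero => simp
  | succ m ih =>
    rw [Finset.sum_range_succ, add_apply, map_add, ih, smul_apply, map_smul,
      ← residualOp_pow_comp, pow_succ, mul_apply_eq_comp, residualOp_apply, map_sub, map_smul]
    abel

end Landweber

/-! ### The forward pass as a partial Neumann sum. -/

section Transformer

variable {X : Type*} [NormedAddCommGroup X] [InnerProductSpace ℝ X] {n : ℕ}

/-- The value operator kills the first component, so the inputs are never changed; the mask removes
the last token from the sum. -/
lemma attentionLayer_kernelActivation (κ : X → X → X →L[ℝ] X) (r : ℝ) (Z : Fin (n + 1) → X × X)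
    (i : Fin (n + 1)) :
    attentionLayer (kernelActivation κ) (ContinuousLinearMap.id ℝ _)
      (ContinuousLinearMap.id ℝ _) (valueOp r) Z i =
      ((Z i).1, (Z i).2 - r • ∑ j : Fin n, κ (Z i).1 (Z j.castSucc).1 (Z j.castSucc).2) := by
  simp only [attentionLayer, Fin.sum_univ_castSucc, mask, if_true, map_zero, add_zero,
    Fin.castSucc_ne_last, if_false, kernelActivation, valueOp]
  ext
  · simp [Prod.fst_sum]
  · simp [Prod.snd_sum, Finset.smul_sum, sub_eq_add_neg]

/-- The parameters of the linear map computed by `m` layers: `∑ k < m, δ (1 - δ K)ᵏ`. -/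
def neumannSum (κ : X → X → X →L[ℝ] X) (δ : ℝ) (f : Fin (n + 1) → X) (m : ℕ) :
    PiLp 2 (fun _ : Fin n => X) →L[ℝ] PiLp 2 (fun _ : Fin n => X) :=
  ∑ k ∈ Finset.range m, δ • (1 - δ • gramOp κ f) ^ k

lemma gramOp_apply (κ : X → X → X →L[ℝ] X) (f : Fin (n + 1) → X)
    (w : PiLp 2 (fun _ : Fin n => X)) (i : Fin n) :
    gramOp κ f w i = ∑ j, κ (f i.castSucc) (f j.castSucc) (w j) := by
  simp [gramOp]

lemma crossOp_apply (κ : X → X → X →L[ℝ] X) (f : Fin (n + 1) → X)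
    (w : PiLp 2 (fun _ : Fin n => X)) :
    crossOp κ f w = ∑ j : Fin n, κ (f (Fin.last n)) (f j.castSucc) (w j) := by
  simp [crossOp]

/-- The three invariants need a joint induction: the observed tokens carry the residual `(1 - δ K) ^
m u`, and the last token accumulates `-δ νᵀ` of these residuals. -/
lemma state_prompt (κ : X → X → X →L[ℝ] X) (δ : ℝ) (f : Fin (n + 1) → X) (u : Fin n → X) (m : ℕ) :
    (∀ i, (state κ (fun _ => δ) (prompt f u) m i).1 = f i) ∧
    (∀ j : Fin n, (state κ (fun _ => δ) (prompt f u) m j.castSucc).2 =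
      ((1 - δ • gramOp κ f) ^ m) (WithLp.toLp 2 u) j) ∧
    (state κ (fun _ => δ) (prompt f u) m (Fin.last n)).2 =
      -crossOp κ f (neumannSum κ δ f m (WithLp.toLp 2 u)) := by
  induction m with
  | zero => simp [state, prompt, neumannSum]
  | succ m ih =>
    obtain ⟨h1, h2, h3⟩ := ih
    simp only [state, attentionLayer_kernelActivation, h1, h2, h3]
    refine ⟨fun _ => trivial, fun j => ?_, ?_⟩
    · rw [← gramOp_apply, pow_succ' (1 - δ • gramOp κ f), mul_apply_eq_comp]
      simp
    · rw [← crossOp_apply, neumannSum, neumannSum, Finset.sum_range_succ]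
      simp only [add_apply, map_add, smul_apply, map_smul]
      abel

lemma transformerPrediction_eq (κ : X → X → X →L[ℝ] X) (δ : ℝ) (m : ℕ) (f : Fin (n + 1) → X)
    (u : Fin n → X) :
    transformerPrediction κ (fun _ => δ) m f u =
      crossOp κ f (neumannSum κ δ f (m + 1) (WithLp.toLp 2 u)) := by
  rw [transformerPrediction, (state_prompt κ δ f u (m + 1)).2.2, neg_neg]

/-- The prediction after `m + 1` layers, as a bounded operator. -/
def predictionOp (κ : X → X → X →L[ℝ] X) (δ : ℝ) (f : Fin (n + 1) → X) (m : ℕ) :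
    (Fin n → X) →L[ℝ] X :=
  (crossOp κ f ∘L neumannSum κ δ f (m + 1)) ∘L
    (PiLp.continuousLinearEquiv 2 ℝ fun _ : Fin n => X).symm.toContinuousLinearMap

lemma predictionOp_apply (κ : X → X → X →L[ℝ] X) (δ : ℝ) (m : ℕ) (f : Fin (n + 1) → X)
    (u : Fin n → X) :
    predictionOp κ δ f m u = transformerPrediction κ (fun _ => δ) m f u := by
  rw [transformerPrediction_eq]; rfl

lemma isUnit_and_hasSum_of_norm_one_sub_smul_lt_one {A : Type*} [NormedRing A] [NormedAlgebra ℝ A]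
    [CompleteSpace A] (K : A) {δ : ℝ} (h : ‖1 - δ • K‖ < 1) :
    IsUnit K ∧ HasSum (fun k : ℕ => δ • (1 - δ • K) ^ k) (Ring.inverse K) := by
  have hs := (summable_geometric_of_norm_lt_one h).hasSum.const_smul δ
  have h1 := geom_series_mul_neg (1 - δ • K) h
  have h2 := mul_neg_geom_series (1 - δ • K) h
  rw [sub_sub_cancel] at h1 h2
  set S := ∑' k : ℕ, (1 - δ • K) ^ k
  have h1' : (δ • S) * K = 1 := by rw [← h1, smul_mul_assoc, mul_smul_comm]
  have h2' : K * (δ • S) = 1 := by rw [← h2, smul_mul_assoc, mul_smul_comm]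
  have hu : IsUnit K := ⟨⟨K, δ • S, h2', h1'⟩, rfl⟩
  have : Ring.inverse K = δ • S := by
    rw [← mul_one (Ring.inverse K), ← h2', ← mul_assoc, Ring.inverse_mul_cancel K hu, one_mul]
  exact ⟨hu, this ▸ hs⟩

lemma tendsto_transformerPrediction [CompleteSpace X] (κ : X → X → X →L[ℝ] X) {δ : ℝ}
    (f : Fin (n + 1) → X) (h : ‖1 - δ • gramOp κ f‖ < 1) (u : Fin n → X) :
    Tendsto (fun m => transformerPrediction κ (fun _ => δ) m f u) atTop
      (𝓝 (krigingPredictor κ f u)) := by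
  have h1 := (isUnit_and_hasSum_of_norm_one_sub_smul_lt_one (gramOp κ f)
    h).2.tendsto_sum_nat.comp (tendsto_add_atTop_nat 1)
  have h2 : Continuous fun T : PiLp 2 (fun _ : Fin n => X) →L[ℝ] PiLp 2 (fun _ : Fin n => X) =>
      crossOp κ f (T (WithLp.toLp 2 u)) := by fun_prop
  refine ((h2.tendsto _).comp h1).congr fun m => ?_
  rw [transformerPrediction_eq]; rfl

variable [MeasurableSpace X] [BorelSpace X] [SecondCountableTopology X]

/-- A Carathéodory function: measurable in the inputs and continuous in the vector, over a separable
space. -/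
lemma measurable_kernel_apply {κ : X → X → X →L[ℝ] X}
    (hκ : ∀ v : X, Measurable fun p : X × X => κ p.1 p.2 v) :
    Measurable fun q : (X × X) × X => κ q.1.1 q.1.2 q.2 :=
  (measurable_uncurry_of_continuous_of_measurable
    (u := fun (v : X) (p : X × X) => κ p.1 p.2 v) (fun p => (κ p.1 p.2).continuous) hκ).comp
    measurable_swap

lemma measurable_state {κ : X → X → X →L[ℝ] X}
    (hκ : ∀ v : X, Measurable fun p : X × X => κ p.1 p.2 v) (δ : ℝ) (m : ℕ) :
    Measurable fun p : (Fin (n + 1) → X) × (Fin n → X) =>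
      state κ (fun _ => δ) (prompt p.1 p.2) m := by
  induction m with
  | zero =>
    refine measurable_pi_lambda _ fun i => ?_
    simp only [state, prompt]
    refine Measurable.prodMk (by fun_prop) ?_
    refine Fin.lastCases ?_ (fun j => ?_) i
    · simp
    · simp only [Fin.snoc_castSucc]; fun_prop
  | succ m ih =>
    refine measurable_pi_lambda _ fun i => ?_
    simp only [state, attentionLayer_kernelActivation]
    have hz (j : Fin (n + 1)) : Measurable fun p : (Fin (n + 1) → X) × (Fin n → X) =>
        state κ (fun _ => δ) (prompt p.1 p.2) m j := (measurable_pi_apply j).comp ih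
    refine Measurable.prodMk (hz i).fst ((hz i).snd.sub (Measurable.const_smul ?_ δ))
    refine Finset.measurable_fun_sum _ fun j _ => ?_
    exact (measurable_kernel_apply hκ).comp
      (((hz i).fst.prodMk (hz j.castSucc).fst).prodMk (hz j.castSucc).snd)

lemma measurable_transformerPrediction {κ : X → X → X →L[ℝ] X}
    (hκ : ∀ v : X, Measurable fun p : X × X => κ p.1 p.2 v) (δ : ℝ) (m : ℕ) :
    Measurable (Function.uncurry (transformerPrediction (n := n) κ (fun _ => δ) m)) :=
  ((measurable_pi_apply (Fin.last n)).comp (measurable_state hκ δ (m + 1))).snd.neg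

end Transformer

/-! ### Parseval for second moments. -/

section HilbertBasis

variable {X : Type*} [NormedAddCommGroup X] [InnerProductSpace ℝ X]

lemma countable_of_hilbertBasis [SecondCountableTopology X] {ι : Type*}
    (b : HilbertBasis ι ℝ X) : Countable ι := by
  refine Pairwise.countable_of_isOpen_disjoint
    (s := fun i => Metric.ball (b i) (1 / 2)) (fun i j hij => Metric.ball_disjoint_ball ?_)
    (fun i => Metric.isOpen_ball) fun i => ⟨b i, Metric.mem_ball_self (by norm_num)⟩
  -- Distinct basis vectors are `√2 > 1` apart, so the balls of radius `1 / 2` are disjoint.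
  have h : ‖b i - b j‖ ^ 2 = 2 := by
    rw [norm_sub_sq_real, b.orthonormal.1, b.orthonormal.1, b.orthonormal.2 hij]; norm_num
  rw [dist_eq_norm]
  nlinarith [norm_nonneg (b i - b j)]

lemma lintegral_enorm_sq_eq_tsum [SecondCountableTopology X] [MeasurableSpace X] [BorelSpace X]
    {ι : Type*} (b : HilbertBasis ι ℝ X) {Ω : Type*} [MeasurableSpace Ω] {μ : Measure Ω}
    {g : Ω → X} (hg : AEMeasurable g μ) :
    ∫⁻ x, ‖g x‖ₑ ^ 2 ∂μ = ∑' i, ∫⁻ x, ‖⟪b i, g x⟫_ℝ‖ₑ ^ 2 ∂μ := by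
  have := countable_of_hilbertBasis b
  rw [← lintegral_tsum fun i => by fun_prop]
  refine lintegral_congr fun x => ?_
  have h := b.hasSum_inner_mul_inner (g x) (g x)
  have h' : HasSum (fun i => ⟪b i, g x⟫_ℝ ^ 2) (‖g x‖ ^ 2) := by
    rw [← real_inner_self_eq_norm_sq]
    simpa only [real_inner_comm (g x), ← sq] using h
  have e1 (y : ℝ) : ‖y‖ₑ ^ 2 = ENNReal.ofReal (y ^ 2) := by
    rw [← ofReal_norm, ← ENNReal.ofReal_pow (norm_nonneg _), Real.norm_eq_abs, sq_abs]
  simp_rw [e1]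
  rw [← ENNReal.ofReal_tsum_of_nonneg (fun i => sq_nonneg _) h'.summable, h'.tsum_eq,
    ENNReal.ofReal_pow (norm_nonneg _), ofReal_norm]

end HilbertBasis

/-! ### Linear functionals as elements of `L²`. -/

section FeatureMap

variable {E : Type*} [NormedAddCommGroup E] [NormedSpace ℝ E]
  {W X : Type*} [NormedAddCommGroup W] [InnerProductSpace ℝ W]
  [NormedAddCommGroup X] [InnerProductSpace ℝ X]

/-- The functional `x ↦ ⟪w, T x⟫`, as a continuous linear function of `w`. -/
def innerComp (T : E →L[ℝ] W) : W →L[ℝ] StrongDual ℝ E :=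
  ((ContinuousLinearMap.compL ℝ E W ℝ).flip T) ∘L
    (isBoundedBilinearMap_inner (𝕜 := ℝ) (E := W)).toContinuousLinearMap

lemma innerComp_apply (T : E →L[ℝ] W) (w : W) (x : E) : innerComp T w x = ⟪w, T x⟫_ℝ := rfl

lemma exists_eq_innerComp [CompleteSpace W] (T : E →L[ℝ] W) (L : StrongDual ℝ W) :
    ∃ w, L ∘L T = innerComp T w := by
  refine ⟨(InnerProductSpace.toDual ℝ W).symm L, ?_⟩
  ext x
  simp [innerComp_apply]

variable [MeasurableSpace E] [BorelSpace E]

/-- The operator `w ↦ ⟪w, T ·⟫` into `L²(μ)`. -/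
def featureMap (μ : Measure E) (T : E →L[ℝ] W) : W →L[ℝ] Lp ℝ 2 μ :=
  StrongDual.toLp μ 2 ∘L innerComp T

lemma featureMap_apply (μ : Measure E) (T : E →L[ℝ] W) (w : W) :
    featureMap μ T w = StrongDual.toLp μ 2 (innerComp T w) := rfl

lemma inner_toLp {μ : Measure E} (h : MemLp id 2 μ) (L₁ L₂ : StrongDual ℝ E) :
    ⟪StrongDual.toLp μ 2 L₁, StrongDual.toLp μ 2 L₂⟫_ℝ = ∫ x, L₁ x * L₂ x ∂μ :=
  uncenteredCovarianceBilinDual_apply h L₁ L₂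

lemma featureMap_sub (μ : Measure E) (S T : E →L[ℝ] W) (w : W) :
    featureMap μ (S - T) w = featureMap μ S w - featureMap μ T w := by
  rw [featureMap_apply, featureMap_apply, featureMap_apply, ← map_sub]
  congr 1
  ext x
  simp [innerComp_apply, inner_sub_right]

/-- Turns a predictor that is linear in the observations into an element of the range of their
feature map. -/
lemma featureMap_comp [CompleteSpace W] [CompleteSpace X] (μ : Measure E) (A : W →L[ℝ] X)
    (T : E →L[ℝ] W) (v : X) :
    featureMap μ (A ∘L T) v = featureMap μ T (ContinuousLinearMap.adjoint A v) := by
  rw [featureMap_apply, featureMap_apply]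
  congr 1
  ext x
  simp [innerComp_apply, ContinuousLinearMap.adjoint_inner_left]

lemma eLpNorm_two_sq {Ω F : Type*} [MeasurableSpace Ω] [NormedAddCommGroup F] {μ : Measure Ω}
    (g : Ω → F) : eLpNorm g 2 μ ^ 2 = ∫⁻ x, ‖g x‖ₑ ^ 2 ∂μ := by
  have h := eLpNorm_nnreal_pow_eq_lintegral (μ := μ) (f := g) (p := 2) (by norm_num)
  simp only [NNReal.coe_ofNat, ENNReal.coe_ofNat, ENNReal.rpow_ofNat] at h
  exact h

lemma enorm_toLp_sq {μ : Measure E} (h : MemLp id 2 μ) (L : StrongDual ℝ E) :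
    ‖StrongDual.toLp μ 2 L‖ₑ ^ 2 = ∫⁻ x, ‖L x‖ₑ ^ 2 ∂μ := by
  rw [StrongDual.toLp_apply h, Lp.enorm_toLp, eLpNorm_two_sq]

lemma coeFn_strongDual_toLp {μ : Measure E} (h : MemLp id 2 μ) (L : StrongDual ℝ E) :
    StrongDual.toLp μ 2 L =ᵐ[μ] L := by
  rw [StrongDual.toLp_apply h]
  exact MemLp.coeFn_toLp _

lemma memLp_two_iff {Ω F : Type*} [MeasurableSpace Ω] [NormedAddCommGroup F] {μ : Measure Ω}
    {g : Ω → F} (hg : AEStronglyMeasurable g μ) : MemLp g 2 μ ↔ ∫⁻ x, ‖g x‖ₑ ^ 2 ∂μ < ∞ := by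
  rw [MemLp, ← eLpNorm_two_sq]
  simp [hg]

lemma tendsto_eLpNorm_two_iff {Ω F ι : Type*} [MeasurableSpace Ω] [NormedAddCommGroup F]
    {μ : Measure Ω} {l : Filter ι} {g : ι → Ω → F} :
    Tendsto (fun k => eLpNorm (g k) 2 μ) l (𝓝 0) ↔
      Tendsto (fun k => ∫⁻ x, ‖g k x‖ₑ ^ 2 ∂μ) l (𝓝 0) := by
  simp_rw [← eLpNorm_two_sq]
  refine ⟨fun h => by simpa using h.ennrpow_const 2, fun h => ?_⟩
  have := h.ennrpow_const (1 / 2)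
  simp_rw [← ENNReal.rpow_natCast, ← ENNReal.rpow_mul] at this
  simpa using this

end FeatureMap

/-! ### Uncorrelated implies independent, for `L²`-limits of Gaussian functionals. -/

section CharFun

variable {Ω : Type*} [MeasurableSpace Ω] {μ : Measure Ω} [IsProbabilityMeasure μ]

/-- Since `|exp (i a) - exp (i b)| ≤ |a - b|` and the `L¹` norm is at most the `L²` norm under a
probability measure, the map is 1-Lipschitz. -/
lemma continuous_integral_cexp_Lp :
    Continuous fun g : Lp ℝ 2 μ => ∫ x, Complex.exp (g x * Complex.I) ∂μ := by
  have hint (g : Lp ℝ 2 μ) : Integrable (fun x => Complex.exp (g x * Complex.I)) μ := by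
    refine Integrable.of_bound (C := 1) ?_ (ae_of_all _ fun x => ?_)
    · have := (Lp.stronglyMeasurable g).measurable
      exact (by fun_prop : Measurable fun x => Complex.exp (g x * Complex.I)).aestronglyMeasurable
    · rw [Complex.norm_exp_ofReal_mul_I]
  refine (LipschitzWith.of_dist_le_mul (K := 1) fun g h => ?_).continuous
  have hgh : Integrable (fun x => ‖g x - h x‖) μ :=
    (((Lp.memLp g).sub (Lp.memLp h)).integrable (by norm_num)).norm
  rw [NNReal.coe_one, one_mul, dist_eq_norm, ← integral_sub (hint g) (hint h), dist_eq_norm]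
  calc ‖∫ x, (Complex.exp (g x * Complex.I) - Complex.exp (h x * Complex.I)) ∂μ‖
      ≤ ∫ x, ‖g x - h x‖ ∂μ := by
        refine norm_integral_le_of_norm_le hgh (ae_of_all _ fun x => ?_)
        have : Complex.exp (g x * Complex.I) - Complex.exp (h x * Complex.I) =
            Complex.exp (h x * Complex.I) *
              (Complex.exp (Complex.I * ((g x - h x : ℝ) : ℂ)) - 1) := by
          rw [mul_sub, ← Complex.exp_add]; push_cast; ring_nf
        rw [this, norm_mul, Complex.norm_exp_ofReal_mul_I, one_mul]
        exact Real.norm_exp_I_mul_ofReal_sub_one_le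
    _ ≤ ‖g - h‖ := by
        rw [Lp.norm_def, integral_norm_eq_lintegral_enorm (f := fun x => g x - h x)
          ((Lp.memLp g).sub (Lp.memLp h)).aestronglyMeasurable]
        refine ENNReal.toReal_mono (Lp.eLpNorm_ne_top _) ?_
        rw [eLpNorm_congr_ae (Lp.coeFn_sub g h), ← eLpNorm_one_eq_lintegral_enorm]
        exact eLpNorm_le_eLpNorm_of_exponent_le (by norm_num)
          ((Lp.memLp g).sub (Lp.memLp h)).aestronglyMeasurable

variable {E : Type*} [NormedAddCommGroup E] [NormedSpace ℝ E] [CompleteSpace E]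
  [SecondCountableTopology E] [MeasurableSpace E] [BorelSpace E]

lemma integral_cexp_toLp {γ : Measure E} [IsGaussian γ] (hγ : ∫ x, x ∂γ = 0)
    (L : StrongDual ℝ E) :
    ∫ x, Complex.exp (StrongDual.toLp γ 2 L x * Complex.I) ∂γ =
      Complex.exp (-(‖StrongDual.toLp γ 2 L‖ ^ 2 : ℝ) / 2) := by
  have h2 := IsGaussian.memLp_two_id (μ := γ)
  have h := IsGaussian.charFunDual_eq_of_integral_eq_zero (μ := γ) hγ L
  have hL : γ[L] = 0 := by rw [IsGaussian.integral_dual, hγ, map_zero]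
  have hv : Var[L; γ] = ‖StrongDual.toLp γ 2 L‖ ^ 2 := by
    rw [← real_inner_self_eq_norm_sq, inner_toLp h2, variance_eq_integral (by fun_prop), hL]
    simp [sq]
  rw [← hv, ← h, charFunDual_apply]
  refine integral_congr_ae ?_
  filter_upwards [coeFn_strongDual_toLp h2 L] with x hx
  rw [hx]

/-- An `L²`-limit of linear functions of a centred Gaussian vector is independent of a linear
function of that vector if it is uncorrelated with it. -/
lemma indepFun_of_tendsto_of_uncorrelated {γ : Measure E} [IsGaussian γ] (hγ : ∫ x, x ∂γ = 0)
    {X G : Type*} [NormedAddCommGroup X] [InnerProductSpace ℝ X] [CompleteSpace X]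
    [SecondCountableTopology X] [MeasurableSpace X] [BorelSpace X]
    [NormedAddCommGroup G] [NormedSpace ℝ G] [CompleteSpace G]
    [SecondCountableTopology G] [MeasurableSpace G] [BorelSpace G]
    {e : E → X} (he : MemLp e 2 γ) (obs : E →L[ℝ] G) {R : ℕ → E →L[ℝ] X}
    (hR : Tendsto (fun m => eLpNorm (fun x => R m x - e x) 2 γ) atTop (𝓝 0))
    (hcov : ∀ (v : X) (L : StrongDual ℝ G), Tendsto (fun m =>
      ⟪featureMap γ (R m) v, StrongDual.toLp γ 2 (L ∘L obs)⟫_ℝ) atTop (𝓝 0)) :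
    IndepFun e obs γ := by
  have h2 := IsGaussian.memLp_two_id (μ := γ)
  rw [indepFun_iff_charFunDual_prod he.aestronglyMeasurable.aemeasurable (by fun_prop)]
  intro L
  set L₁ := L.comp (.inl ℝ X G) with hL₁
  set L₂ := L.comp (.inr ℝ X G) with hL₂
  have hLadd (x : X) (y : G) : L (x, y) = L₁ x + L₂ y := by
    simp [hL₁, hL₂, ← map_add]
  have hZ := L₁.comp_memLp' he
  set Z : Lp ℝ 2 γ := hZ.toLp with hZdef
  set V := StrongDual.toLp γ 2 (L₂ ∘L obs) with hV
  have hlim : Tendsto (fun m => StrongDual.toLp γ 2 (L₁ ∘L R m)) atTop (𝓝 Z) := by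
    rw [tendsto_iff_edist_tendsto_0]
    have hc : Tendsto (fun m => ‖L₁‖ₑ * eLpNorm (fun x => R m x - e x) 2 γ) atTop (𝓝 0) := by
      simpa using ENNReal.Tendsto.const_mul hR (Or.inr enorm_ne_top)
    refine tendsto_of_tendsto_of_tendsto_of_le_of_le tendsto_const_nhds hc
      (fun m => zero_le) fun m => ?_
    rw [StrongDual.toLp_apply h2, hZdef, Lp.edist_toLp_toLp]
    refine (eLpNorm_le_nnreal_smul_eLpNorm_of_ae_le_mul (c := ‖L₁‖₊)
      (ae_of_all _ fun x => ?_) 2).trans_eq (by rw [ENNReal.smul_def, smul_eq_mul]; rfl)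
    have := L₁.le_opNNNorm (R m x - e x)
    rwa [map_sub] at this
  -- The centred Gaussian formula, with variance `‖g‖²`, is a closed condition on `g`. It passes to
  -- the limits `Z` and `Z + V`, although `e` need not be continuous or linear.
  have hcl : IsClosed {g : Lp ℝ 2 γ | ∫ x, Complex.exp (g x * Complex.I) ∂γ =
      Complex.exp (-(‖g‖ ^ 2 : ℝ) / 2)} :=
    isClosed_eq continuous_integral_cexp_Lp (by fun_prop)
  have hZc : Z ∈ {g : Lp ℝ 2 γ | ∫ x, Complex.exp (g x * Complex.I) ∂γ =
      Complex.exp (-(‖g‖ ^ 2 : ℝ) / 2)} :=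
    hcl.mem_of_tendsto hlim (Eventually.of_forall fun m => integral_cexp_toLp hγ _)
  have hZVc : Z + V ∈ {g : Lp ℝ 2 γ | ∫ x, Complex.exp (g x * Complex.I) ∂γ =
      Complex.exp (-(‖g‖ ^ 2 : ℝ) / 2)} := by
    refine hcl.mem_of_tendsto (hlim.add_const V) (Eventually.of_forall fun m => ?_)
    rw [hV, ← map_add]
    exact integral_cexp_toLp hγ _
  have hVc := integral_cexp_toLp hγ (L₂ ∘L obs)
  have horth : ⟪Z, V⟫_ℝ = 0 := by
    have hm (m : ℕ) : StrongDual.toLp γ 2 (L₁ ∘L R m) =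
        featureMap γ (R m) ((InnerProductSpace.toDual ℝ X).symm L₁) := by
      rw [featureMap_apply]
      congr 1
      ext x
      simp [innerComp_apply]
    simp_rw [hm] at hlim
    exact tendsto_nhds_unique (hlim.inner tendsto_const_nhds) (hcov _ L₂)
  -- Orthogonality adds the variances, so the joint characteristic function factors.
  have hnorm : ‖Z + V‖ ^ 2 = ‖Z‖ ^ 2 + ‖V‖ ^ 2 := by
    rw [norm_add_sq_real, horth]; ring
  have hZe := hZ.coeFn_toLp
  have hVe := coeFn_strongDual_toLp h2 (L₂ ∘L obs)
  have c1 : charFunDual (γ.map fun x => (e x, obs x)) L =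
      ∫ x, Complex.exp ((Z + V : Lp ℝ 2 γ) x * Complex.I) ∂γ := by
    rw [charFunDual_apply, integral_map
      (he.aestronglyMeasurable.aemeasurable.prodMk (by fun_prop)) (by fun_prop)]
    refine integral_congr_ae ?_
    filter_upwards [hZe, hVe, Lp.coeFn_add Z V] with x h1 h2 h3
    rw [h3, Pi.add_apply, h1, h2, hLadd]; rfl
  have c2 : charFunDual (γ.map e) L₁ = ∫ x, Complex.exp (Z x * Complex.I) ∂γ := by
    rw [charFunDual_apply, integral_map he.aestronglyMeasurable.aemeasurable (by fun_prop)]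
    refine integral_congr_ae ?_
    filter_upwards [hZe] with x h1
    rw [h1]; rfl
  have c3 : charFunDual (γ.map obs) L₂ = ∫ x, Complex.exp (V x * Complex.I) ∂γ := by
    rw [charFunDual_apply, integral_map (by fun_prop) (by fun_prop)]
    refine integral_congr_ae ?_
    filter_upwards [hVe] with x h1
    rw [h1]; rfl
  rw [c1, c2, c3, hZc, hZVc, hVc, hnorm, ← Complex.exp_add]
  congr 1
  push_cast
  ring

end CharFun

/-! ### Orthogonality of an independent centred error to every function of the observation. -/

section Pythagoras

variable {Ω : Type*} [MeasurableSpace Ω] {μ : Measure Ω} [IsProbabilityMeasure μ]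
  {X G : Type*} [NormedAddCommGroup X] [InnerProductSpace ℝ X] [CompleteSpace X]
  [SecondCountableTopology X] [MeasurableSpace X] [BorelSpace X] [MeasurableSpace G]

omit [CompleteSpace X] [SecondCountableTopology X] [MeasurableSpace X] [BorelSpace X]
  [IsProbabilityMeasure μ] in
lemma integrable_inner_of_memLp {g h : Ω → X} (hg : MemLp g 2 μ) (hh : MemLp h 2 μ) :
    Integrable (fun x => ⟪g x, h x⟫_ℝ) μ := by
  refine (L2.integrable_inner (𝕜 := ℝ) hg.toLp hh.toLp).congr ?_
  filter_upwards [hg.coeFn_toLp, hh.coeFn_toLp] with x h1 h2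
  rw [h1, h2]

lemma integral_inner_eq_zero_of_indepFun {e : Ω → X} {obs : Ω → G} (he : MemLp e 2 μ)
    (hobs : AEMeasurable obs μ) (hind : IndepFun e obs μ) (hmean : ∫ x, e x ∂μ = 0)
    {h : G → X} (hh : Measurable h) (hh2 : MemLp (fun x => h (obs x)) 2 μ) :
    ∫ x, ⟪e x, h (obs x)⟫_ℝ ∂μ = 0 := by
  have hem := he.aestronglyMeasurable.aemeasurable
  have hpair := hem.prodMk hobs
  have hmeas : Measurable fun p : X × G => ⟪p.1, h p.2⟫_ℝ := by fun_prop
  have hint : Integrable (fun p : X × G => ⟪p.1, h p.2⟫_ℝ) (μ.map fun x => (e x, obs x)) := by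
    rw [integrable_map_measure hmeas.aestronglyMeasurable hpair]
    exact integrable_inner_of_memLp he hh2
  have := Measure.isProbabilityMeasure_map hobs
  have := Measure.isProbabilityMeasure_map hem
  have h1 : ∫ x, ⟪e x, h (obs x)⟫_ℝ ∂μ =
      ∫ p, ⟪p.1, h p.2⟫_ℝ ∂(μ.map fun x => (e x, obs x)) := by
    rw [integral_map hpair hmeas.aestronglyMeasurable]
  rw [(indepFun_iff_map_prod_eq_prod_map_map hem hobs).1 hind] at h1 hint
  rw [h1, integral_prod_symm _ hint]
  -- Under the product law, the error is integrated first, with the observation `y` frozen.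
  refine integral_eq_zero_of_ae (ae_of_all _ fun y => ?_)
  have hid : Integrable (fun x : X => x) (μ.map e) := by
    have := he.integrable (by norm_num)
    exact (integrable_map_measure (g := fun x : X => x) (by fun_prop) hem).2 this
  have hmean' : ∫ x, x ∂(μ.map e) = 0 := by
    rw [integral_map hem (by fun_prop), hmean]
  simp_rw [real_inner_comm (h y)]
  rw [integral_inner hid, hmean', inner_zero_right]; rfl

/-- Pythagoras for a centred square-integrable error that is independent of the observation. -/
lemma lintegral_enorm_add_sq_of_indepFun {e : Ω → X} {obs : Ω → G} (he : MemLp e 2 μ)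
    (hobs : Measurable obs) (hind : IndepFun e obs μ) (hmean : ∫ x, e x ∂μ = 0)
    {h : G → X} (hh : Measurable h) :
    ∫⁻ x, ‖e x + h (obs x)‖ₑ ^ 2 ∂μ = ∫⁻ x, ‖e x‖ₑ ^ 2 ∂μ + ∫⁻ x, ‖h (obs x)‖ₑ ^ 2 ∂μ := by
  have hm : AEStronglyMeasurable (fun x => h (obs x)) μ := (hh.comp hobs).aestronglyMeasurable
  by_cases hh2 : MemLp (fun x => h (obs x)) 2 μ
  · have key {g : Ω → X} (hg : MemLp g 2 μ) :
        ∫⁻ x, ‖g x‖ₑ ^ 2 ∂μ = ENNReal.ofReal (∫ x, ‖g x‖ ^ 2 ∂μ) := by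
      rw [ofReal_integral_eq_lintegral_ofReal hg.integrable_norm_pow'
        (ae_of_all _ fun x => by positivity)]
      refine lintegral_congr fun x => ?_
      rw [ENNReal.ofReal_pow (norm_nonneg _), ofReal_norm]
    rw [key he, key hh2, key (g := fun x => e x + h (obs x)) (he.add hh2), ← ENNReal.ofReal_add
      (integral_nonneg fun x => by positivity) (integral_nonneg fun x => by positivity)]
    congr 1
    have i0 := integral_inner_eq_zero_of_indepFun he hobs.aemeasurable hind hmean hh hh2
    simp only [norm_add_sq_real]
    have j1 : Integrable (fun x => ‖e x‖ ^ 2) μ := he.integrable_norm_pow (by norm_num)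
    have j2 : Integrable (fun x => ‖h (obs x)‖ ^ 2) μ := hh2.integrable_norm_pow (by norm_num)
    have j3 : Integrable (fun x => 2 * ⟪e x, h (obs x)⟫_ℝ) μ :=
      (integrable_inner_of_memLp he hh2).const_mul 2
    have j13 : Integrable (fun x => ‖e x‖ ^ 2 + 2 * ⟪e x, h (obs x)⟫_ℝ) μ := j1.add j3
    rw [integral_add j13 j2, integral_add j1 j3, integral_const_mul, i0]
    ring
  -- Outside `L²` both sides are infinite, because `e` is in `L²`. Competitors thus need no moment
  -- condition.
  · have t1 : ∫⁻ x, ‖h (obs x)‖ₑ ^ 2 ∂μ = ∞ := by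
      by_contra hne
      exact hh2 ((memLp_two_iff hm).2 (lt_top_iff_ne_top.2 hne))
    have t2 : ∫⁻ x, ‖e x + h (obs x)‖ₑ ^ 2 ∂μ = ∞ := by
      by_contra hne
      have := (memLp_two_iff (he.aestronglyMeasurable.add hm)).2 (lt_top_iff_ne_top.2 hne)
      exact hh2 (by simpa using this.sub he)
    rw [t1, t2, add_top]

end Pythagoras

/-! ### Prediction for fixed inputs: the error as a Landweber residual, and its limit. -/

section Fibre

variable {X : Type*} [NormedAddCommGroup X] [InnerProductSpace ℝ X] {n : ℕ}

/-- The observation map `(u_1, …, u_{n+1}) ↦ (u_1, …, u_n)`. -/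
def observedCLM (X : Type*) [NormedAddCommGroup X] [InnerProductSpace ℝ X] (n : ℕ) :
    (Fin (n + 1) → X) →L[ℝ] (Fin n → X) :=
  ContinuousLinearMap.pi fun i => ContinuousLinearMap.proj i.castSucc

/-- The observation map, with values in the Hilbert space `X ^ n`. -/
def observedL2 (X : Type*) [NormedAddCommGroup X] [InnerProductSpace ℝ X] (n : ℕ) :
    (Fin (n + 1) → X) →L[ℝ] PiLp 2 (fun _ : Fin n => X) :=
  (PiLp.continuousLinearEquiv 2 ℝ fun _ : Fin n => X).symm.toContinuousLinearMap ∘L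
    observedCLM X n

/-- The map `(u_1, …, u_{n+1}) ↦ u_{n+1}`. -/
def lastCLM (X : Type*) [NormedAddCommGroup X] [InnerProductSpace ℝ X] (n : ℕ) :
    (Fin (n + 1) → X) →L[ℝ] X :=
  ContinuousLinearMap.proj (Fin.last n)

/-- The prediction error after `m + 1` layers, as a bounded operator. -/
def errorOp (κ : X → X → X →L[ℝ] X) (δ : ℝ) (f : Fin (n + 1) → X) (m : ℕ) :
    (Fin (n + 1) → X) →L[ℝ] X :=
  lastCLM X n - predictionOp κ δ f m ∘L observedCLM X n

lemma errorOp_apply (κ : X → X → X →L[ℝ] X) (δ : ℝ) (f : Fin (n + 1) → X) (m : ℕ)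
    (u : Fin (n + 1) → X) :
    errorOp κ δ f m u =
      u (Fin.last n) - transformerPrediction κ (fun _ => δ) m f (observed u) := by
  rw [← predictionOp_apply]; rfl

variable [CompleteSpace X] [SecondCountableTopology X] [MeasurableSpace X] [BorelSpace X]
  {κ : X → X → X →L[ℝ] X} {f : Fin (n + 1) → X} {μ : Measure (Fin (n + 1) → X)} {δ : ℝ}

omit [CompleteSpace X] in
lemma measurable_observed : Measurable (observed : (Fin (n + 1) → X) → Fin n → X) :=
  (observedCLM X n).continuous.measurable

lemma IsKappaGaussian.integral_eq_zero (hμ : IsKappaGaussian κ f μ) : ∫ u, u ∂μ = 0 := by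
  have := hμ.jointly_gaussian
  have hint : Integrable (fun u : Fin (n + 1) → X => u) μ := IsGaussian.integrable_id
  ext i
  refine ext_inner_left ℝ fun v => ?_
  have h1 : ∫ u : Fin (n + 1) → X, ⟪v, u i⟫_ℝ ∂μ = 0 := by
    rw [← integral_map (μ := μ) (φ := fun u => ⟪v, u i⟫_ℝ) (f := fun x : ℝ => x)
      (by fun_prop : Continuous fun u : Fin (n + 1) → X => ⟪v, u i⟫_ℝ).measurable.aemeasurable
      (by fun_prop), hμ.marginal, integral_id_gaussianReal]
  have h2 := ContinuousLinearMap.integral_comp_comm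
    ((innerSL ℝ v) ∘L (ContinuousLinearMap.proj i : (Fin (n + 1) → X) →L[ℝ] X)) hint
  simp only [ContinuousLinearMap.comp_apply, ContinuousLinearMap.proj_apply, innerSL_apply_apply,
    h1] at h2
  simpa using h2.symm

open ContinuousLinearMap in
lemma IsKappaGaussian.adjoint_featureMap_comp (hμ : IsKappaGaussian κ f μ) :
    adjoint (featureMap μ (observedL2 X n)) ∘L featureMap μ (observedL2 X n) = gramOp κ f := by
  have := hμ.jointly_gaussian
  have h2 := IsGaussian.memLp_two_id (μ := μ)
  have hint (v w : X) (i j : Fin (n + 1)) :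
      Integrable (fun u : Fin (n + 1) → X => ⟪v, u i⟫_ℝ * ⟪w, u j⟫_ℝ) μ :=
    (h2.continuousLinearMap_comp ((innerSL ℝ v) ∘L proj i)).integrable_mul
      (h2.continuousLinearMap_comp ((innerSL ℝ w) ∘L proj j))
  ext1 w
  refine ext_inner_left ℝ fun v => ?_
  rw [comp_apply, adjoint_inner_right, featureMap_apply, featureMap_apply, inner_toLp h2]
  simp only [innerComp_apply, PiLp.inner_apply, gramOp_apply, inner_sum, Finset.sum_mul_sum]
  have hobs (u : Fin (n + 1) → X) (i : Fin n) : observedL2 X n u i = u i.castSucc := rfl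
  simp only [hobs]
  rw [integral_finsetSum _ fun i _ => integrable_finsetSum _ fun j _ => hint _ _ _ _]
  refine Finset.sum_congr rfl fun i _ => ?_
  rw [integral_finsetSum _ fun j _ => hint _ _ _ _]
  exact Finset.sum_congr rfl fun j _ => hμ.covariance _ _ _ _

open ContinuousLinearMap in
lemma IsKappaGaussian.adjoint_featureMap_last (hμ : IsKappaGaussian κ f μ) (v : X) :
    adjoint (featureMap μ (observedL2 X n)) (featureMap μ (lastCLM X n) v) =
      adjoint (crossOp κ f) v := by
  have := hμ.jointly_gaussian
  have h2 := IsGaussian.memLp_two_id (μ := μ)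
  have hint (v w : X) (i j : Fin (n + 1)) :
      Integrable (fun u : Fin (n + 1) → X => ⟪v, u i⟫_ℝ * ⟪w, u j⟫_ℝ) μ :=
    (h2.continuousLinearMap_comp ((innerSL ℝ v) ∘L proj i)).integrable_mul
      (h2.continuousLinearMap_comp ((innerSL ℝ w) ∘L proj j))
  refine ext_inner_right ℝ fun w => ?_
  rw [adjoint_inner_left, adjoint_inner_left, featureMap_apply, featureMap_apply, inner_toLp h2]
  simp only [innerComp_apply, PiLp.inner_apply, crossOp_apply, inner_sum, Finset.mul_sum]
  have hobs (u : Fin (n + 1) → X) (i : Fin n) : observedL2 X n u i = u i.castSucc := rfl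
  have hlast (u : Fin (n + 1) → X) : lastCLM X n u = u (Fin.last n) := rfl
  simp only [hobs, hlast]
  rw [integral_finsetSum _ fun i _ => hint _ _ _ _]
  exact Finset.sum_congr rfl fun i _ => hμ.covariance _ _ _ _

open ContinuousLinearMap in
lemma IsKappaGaussian.isSelfAdjoint_gramOp (hμ : IsKappaGaussian κ f μ) :
    IsSelfAdjoint (gramOp κ f) := by
  rw [← hμ.adjoint_featureMap_comp, isSelfAdjoint_iff', adjoint_comp, adjoint_adjoint]

/-- The identity `‖J† J‖ = ‖J‖²` turns the bound on the Gram operator into the Landweber step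
condition. -/
lemma IsKappaGaussian.mul_norm_featureMap_sq_lt (hμ : IsKappaGaussian κ f μ)
    (h : δ * ‖gramOp κ f‖ < 2) : δ * ‖featureMap μ (observedL2 X n)‖ ^ 2 < 2 := by
  rw [sq, ← ContinuousLinearMap.norm_adjoint_comp_self, hμ.adjoint_featureMap_comp]
  exact h

-- The link between the transformer and Landweber: with `y` the feature of `u_{n+1}`, the prediction
-- has feature `J N J† y`, where the Neumann sum `N` is self-adjoint and `J† y` is `νᵀ` transposed.
open ContinuousLinearMap in
lemma IsKappaGaussian.featureMap_errorOp (hμ : IsKappaGaussian κ f μ) (m : ℕ) (v : X) :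
    featureMap μ (errorOp κ δ f m) v =
      (residualOp (featureMap μ (observedL2 X n)) δ ^ (m + 1)) (featureMap μ (lastCLM X n) v) := by
  have hN : adjoint (neumannSum κ δ f (m + 1)) = neumannSum κ δ f (m + 1) := by
    rw [← isSelfAdjoint_iff', neumannSum]
    refine isSelfAdjoint_sum _ fun k _ => ?_
    exact (IsSelfAdjoint.all δ).smul
      (((IsSelfAdjoint.one _).sub ((IsSelfAdjoint.all δ).smul hμ.isSelfAdjoint_gramOp)).pow k)
  have hA : predictionOp κ δ f m ∘L observedCLM X n =
      (crossOp κ f ∘L neumannSum κ δ f (m + 1)) ∘L observedL2 X n := rfl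
  rw [errorOp, featureMap_sub, hA, featureMap_comp, adjoint_comp, comp_apply, hN,
    ← hμ.adjoint_featureMap_last, neumannSum, ← hμ.adjoint_featureMap_comp,
    sum_residualOp_pow_comp_adjoint, sub_sub_cancel]

omit [CompleteSpace X] in
lemma lintegral_enorm_clm_sq_eq_tsum {E : Type*} [NormedAddCommGroup E] [NormedSpace ℝ E]
    [MeasurableSpace E] [BorelSpace E] {γ : Measure E} (h2 : MemLp id 2 γ) {ι : Type*}
    (b : HilbertBasis ι ℝ X) (S : E →L[ℝ] X) :
    ∫⁻ x, ‖S x‖ₑ ^ 2 ∂γ = ∑' i, ‖featureMap γ S (b i)‖ₑ ^ 2 := by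
  rw [lintegral_enorm_sq_eq_tsum b (by fun_prop)]
  exact tsum_congr fun i => (enorm_toLp_sq h2 (innerComp S (b i))).symm

/-- The mean squared error of the transformer is at most that of the zero predictor. -/
lemma IsKappaGaussian.meanSquareError_transformerPrediction_le (hμ : IsKappaGaussian κ f μ)
    (hδ : 0 < δ) (h : δ * ‖gramOp κ f‖ < 2) (m : ℕ) :
    meanSquareError μ (transformerPrediction κ (fun _ => δ) m f) ≤
      ∫⁻ u, ‖u (Fin.last n)‖ₑ ^ 2 ∂μ := by
  have := hμ.jointly_gaussian
  have h2 := IsGaussian.memLp_two_id (μ := μ)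
  obtain ⟨w, b, -⟩ := exists_hilbertBasis ℝ X
  have h1 : meanSquareError μ (transformerPrediction κ (fun _ => δ) m f) =
      ∫⁻ u, ‖errorOp κ δ f m u‖ₑ ^ 2 ∂μ := by
    simp only [errorOp_apply]; rfl
  have h3 : ∫⁻ u, ‖u (Fin.last n)‖ₑ ^ 2 ∂μ = ∫⁻ u, ‖lastCLM X n u‖ₑ ^ 2 ∂μ := rfl
  rw [h1, h3, lintegral_enorm_clm_sq_eq_tsum h2 b, lintegral_enorm_clm_sq_eq_tsum h2 b]
  refine ENNReal.tsum_le_tsum fun i => ?_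
  gcongr
  rw [hμ.featureMap_errorOp, ← ofReal_norm, ← ofReal_norm]
  exact ENNReal.ofReal_le_ofReal
    (norm_residualOp_pow_le hδ (hμ.mul_norm_featureMap_sq_lt h) _ _)

lemma enorm_sub_sq_le {F : Type*} [NormedAddCommGroup F] (x y z : F) :
    ‖x - y‖ₑ ^ 2 ≤ 2 * (‖x - z‖ₑ ^ 2 + ‖y - z‖ₑ ^ 2) := by
  have h1 : ‖x - y‖₊ ≤ ‖x - z‖₊ + ‖y - z‖₊ := by
    have := nnnorm_sub_le (x - z) (y - z)
    rwa [sub_sub_sub_cancel_right] at this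
  have h2 : ‖x - y‖₊ ^ 2 ≤ 2 * (‖x - z‖₊ ^ 2 + ‖y - z‖₊ ^ 2) :=
    (pow_le_pow_left₀ (zero_le) h1 2).trans add_sq_le
  simp only [enorm_eq_nnnorm]
  exact_mod_cast h2

lemma tendsto_tsum_zero_of_dominated {ι : Type*} {F : ℕ → ι → ℝ≥0∞} {bound : ι → ℝ≥0∞}
    (hb : ∑' i, bound i ≠ ∞) (hF : ∀ m i, F m i ≤ bound i)
    (hlim : ∀ i, Tendsto (fun m => F m i) atTop (𝓝 0)) :
    Tendsto (fun m => ∑' i, F m i) atTop (𝓝 0) := by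
  let _ : MeasurableSpace ι := ⊤
  have := tendsto_lintegral_of_dominated_convergence (μ := Measure.count) (F := F)
    (f := fun _ => 0) bound (fun m => measurable_from_top) (fun m => ae_of_all _ (hF m))
    (by rwa [lintegral_count]) (ae_of_all _ hlim)
  simpa [lintegral_count] using this

omit [CompleteSpace X] in
lemma predictorDist_eq (g h : (Fin n → X) → X) (hg : Measurable g) (hh : Measurable h) :
    predictorDist μ g h = ∫⁻ y, ‖g y - h y‖ₑ ^ 2 ∂(μ.map observed) := by
  rw [lintegral_map (by fun_prop) measurable_observed]; rfl

omit [CompleteSpace X] in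
lemma measurable_transformerPrediction_right (m : ℕ) :
    Measurable (transformerPrediction κ (fun _ => δ) m f) := by
  simp only [funext fun u => (predictionOp_apply κ δ m f u).symm]
  fun_prop

lemma IsKappaGaussian.tendsto_predictorDist_transformerPrediction (hμ : IsKappaGaussian κ f μ)
    (hδ : 0 < δ) (h : δ * ‖gramOp κ f‖ < 2) :
    Tendsto (fun p : ℕ × ℕ => predictorDist μ (transformerPrediction κ (fun _ => δ) p.1 f)
      (transformerPrediction κ (fun _ => δ) p.2 f)) atTop (𝓝 0) := by
  have := hμ.jointly_gaussian
  have h2 := IsGaussian.memLp_two_id (μ := μ)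
  have hJ := hμ.mul_norm_featureMap_sq_lt h
  obtain ⟨w, b, -⟩ := exists_hilbertBasis ℝ X
  choose z _ hz hzle using fun i =>
    exists_tendsto_residualOp_pow hδ hJ (featureMap μ (lastCLM X n) (b i))
  -- The squared distance to the coordinatewise limits. Each term is bounded uniformly in `m` by the
  -- second moment of a coordinate of `u_{n+1}`, and these sum to a finite Gaussian moment.
  set a : ℕ → ℝ≥0∞ := fun m => ∑' i, ‖featureMap μ (errorOp κ δ f m) (b i) - z i‖ₑ ^ 2 with ha
  have ha0 : Tendsto a atTop (𝓝 0) := by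
    refine tendsto_tsum_zero_of_dominated
      (bound := fun i => ‖featureMap μ (lastCLM X n) (b i)‖ₑ ^ 2) ?_ (fun m i => ?_) fun i => ?_
    · rw [← lintegral_enorm_clm_sq_eq_tsum h2 b, ← eLpNorm_two_sq]
      exact ENNReal.pow_ne_top (h2.continuousLinearMap_comp (lastCLM X n)).eLpNorm_ne_top
    · gcongr
      rw [hμ.featureMap_errorOp, ← ofReal_norm, ← ofReal_norm]
      exact ENNReal.ofReal_le_ofReal (hzle i _)
    · have h1 := tendsto_iff_edist_tendsto_0.1 ((hz i).comp (tendsto_add_atTop_nat 1))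
      simp only [Function.comp_apply, edist_eq_enorm_sub, ← hμ.featureMap_errorOp] at h1
      simpa using ENNReal.Tendsto.pow (n := 2) h1
  have hle (p : ℕ × ℕ) : predictorDist μ (transformerPrediction κ (fun _ => δ) p.1 f)
      (transformerPrediction κ (fun _ => δ) p.2 f) ≤ 2 * (a p.1 + a p.2) := by
    have h1 : predictorDist μ (transformerPrediction κ (fun _ => δ) p.1 f)
        (transformerPrediction κ (fun _ => δ) p.2 f) =
        ∫⁻ u, ‖(errorOp κ δ f p.2 - errorOp κ δ f p.1) u‖ₑ ^ 2 ∂μ := by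
      simp only [sub_apply, errorOp_apply, sub_sub_sub_cancel_left]; rfl
    rw [h1, lintegral_enorm_clm_sq_eq_tsum h2 b, add_comm (a p.1)]
    simp only [ha]
    rw [← ENNReal.tsum_add, ← ENNReal.tsum_mul_left]
    refine ENNReal.tsum_le_tsum fun i => ?_
    rw [featureMap_sub]
    exact enorm_sub_sq_le _ _ _
  rw [← prod_atTop_atTop_eq]
  refine tendsto_of_tendsto_of_tendsto_of_le_of_le tendsto_const_nhds ?_ (fun _ => zero_le) hle
  have h3 := ENNReal.Tendsto.const_mul (a := 2)
    ((ha0.comp (tendsto_fst (f := atTop) (g := (atTop : Filter ℕ)))).add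
      (ha0.comp (tendsto_snd (f := (atTop : Filter ℕ)) (g := atTop)))) (Or.inr (by norm_num))
  simpa using h3

/-- Completeness is used in `L²` of the law of the observed part, so that the limit is a function of
the observations only. -/
lemma IsKappaGaussian.exists_tendsto_predictorDist (hμ : IsKappaGaussian κ f μ)
    (hδ : 0 < δ) (h : δ * ‖gramOp κ f‖ < 2) :
    ∃ b : (Fin n → X) → X, Measurable b ∧ Tendsto (fun m => predictorDist μ
      (transformerPrediction κ (fun _ => δ) m f) b) atTop (𝓝 0) := by
  have := hμ.jointly_gaussian
  have h2 := IsGaussian.memLp_two_id (μ := μ)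
  have hid : MemLp id 2 (μ.map (observed : (Fin (n + 1) → X) → Fin n → X)) :=
    (memLp_map_measure_iff aestronglyMeasurable_id measurable_observed.aemeasurable).2
      (h2.continuousLinearMap_comp (observedCLM X n))
  have hT (m : ℕ) : MemLp (transformerPrediction κ (fun _ => δ) m f) 2 (μ.map observed) := by
    simp only [funext fun u => (predictionOp_apply κ δ m f u).symm]
    exact hid.continuousLinearMap_comp (predictionOp κ δ f m)
  have hc : CauchySeq fun m => (hT m).toLp := by
    rw [cauchySeq_iff_tendsto_dist_atTop_0]
    have h1 := hμ.tendsto_predictorDist_transformerPrediction hδ h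
    simp only [predictorDist_eq _ _ (measurable_transformerPrediction_right _)
      (measurable_transformerPrediction_right _)] at h1
    have h3 := tendsto_eLpNorm_two_iff.2 h1
    have h4 := (ENNReal.tendsto_toReal ENNReal.zero_ne_top).comp h3
    refine h4.congr fun p => ?_
    rw [dist_edist, Lp.edist_toLp_toLp]; rfl
  obtain ⟨b, hb⟩ := cauchySeq_tendsto_of_complete hc
  have hbm := (Lp.stronglyMeasurable b).measurable
  refine ⟨b, hbm, ?_⟩
  simp only [predictorDist_eq _ _ (measurable_transformerPrediction_right _) hbm]
  rw [← tendsto_eLpNorm_two_iff]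
  refine (tendsto_iff_edist_tendsto_0.1 hb).congr fun m => ?_
  rw [Lp.edist_def]
  refine eLpNorm_congr_ae ?_
  filter_upwards [(hT m).coeFn_toLp] with x hx
  rw [Pi.sub_apply, hx]

end Fibre

/-! ### Optimality and uniqueness of the limit, for fixed inputs. -/

section Optimality

variable {X : Type*} [NormedAddCommGroup X] [InnerProductSpace ℝ X] {n : ℕ}
  [CompleteSpace X] [SecondCountableTopology X] [MeasurableSpace X] [BorelSpace X]
  {κ : X → X → X →L[ℝ] X} {f : Fin (n + 1) → X} {μ : Measure (Fin (n + 1) → X)} {δ : ℝ}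
  {g : (Fin n → X) → X}

omit [InnerProductSpace ℝ X] [CompleteSpace X] [SecondCountableTopology X] [BorelSpace X] in
lemma predictorDist_comm (g h : (Fin n → X) → X) : predictorDist μ g h = predictorDist μ h g := by
  simp only [predictorDist, enorm_sub_rev]

omit [CompleteSpace X] in
lemma ae_eq_of_predictorDist_eq_zero {g h : (Fin n → X) → X} (hg : Measurable g)
    (hh : Measurable h) (h0 : predictorDist μ g h = 0) :
    ∀ᵐ u ∂μ, g (observed u) = h (observed u) := by
  have hm : Measurable fun u : Fin (n + 1) → X => ‖g (observed u) - h (observed u)‖ₑ ^ 2 :=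
    (((hg.comp measurable_observed).sub (hh.comp measurable_observed)).enorm).pow_const 2
  filter_upwards [(lintegral_eq_zero_iff hm).1 h0] with u hu
  simpa [sub_eq_zero] using hu

/-- The error `u_{n+1} - g (u_1, …, u_n)` of a predictor. -/
def predictionError (g : (Fin n → X) → X) (u : Fin (n + 1) → X) : X :=
  u (Fin.last n) - g (observed u)

omit [CompleteSpace X] in
lemma measurable_predictionError (hg : Measurable g) : Measurable (predictionError g) :=
  (measurable_pi_apply _).sub (hg.comp measurable_observed)

omit [CompleteSpace X] [SecondCountableTopology X] [BorelSpace X] in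
lemma tendsto_eLpNorm_errorOp_sub (hlim : Tendsto (fun m => predictorDist μ
      (transformerPrediction κ (fun _ => δ) m f) g) atTop (𝓝 0)) :
    Tendsto (fun m => eLpNorm (fun u => errorOp κ δ f m u - predictionError g u) 2 μ)
      atTop (𝓝 0) := by
  rw [tendsto_eLpNorm_two_iff]
  refine hlim.congr fun m => lintegral_congr fun u => ?_
  rw [errorOp_apply, predictionError, sub_sub_sub_cancel_left, enorm_sub_rev]

lemma IsKappaGaussian.memLp_predictionError (hμ : IsKappaGaussian κ f μ) (hg : Measurable g)
    (hlim : Tendsto (fun m => predictorDist μ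
      (transformerPrediction κ (fun _ => δ) m f) g) atTop (𝓝 0)) :
    MemLp (predictionError g) 2 μ := by
  have := hμ.jointly_gaussian
  have hR (m : ℕ) : MemLp (errorOp κ δ f m) 2 μ :=
    IsGaussian.memLp_two_id.continuousLinearMap_comp (errorOp κ δ f m)
  obtain ⟨m, hm⟩ := ((tendsto_eLpNorm_errorOp_sub hlim).eventually_lt_const
    (ENNReal.zero_lt_top)).exists
  have h1 : MemLp (fun u => errorOp κ δ f m u - predictionError g u) 2 μ :=
    ⟨((hR m).aestronglyMeasurable).sub (measurable_predictionError hg).aestronglyMeasurable, hm⟩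
  convert (hR m).sub h1 using 1
  ext u
  simp

lemma IsKappaGaussian.integral_predictionError (hμ : IsKappaGaussian κ f μ) (hg : Measurable g)
    (hlim : Tendsto (fun m => predictorDist μ
      (transformerPrediction κ (fun _ => δ) m f) g) atTop (𝓝 0)) :
    ∫ u, predictionError g u ∂μ = 0 := by
  have := hμ.jointly_gaussian
  have hR (m : ℕ) : MemLp (errorOp κ δ f m) 2 μ :=
    IsGaussian.memLp_two_id.continuousLinearMap_comp (errorOp κ δ f m)
  have he := hμ.memLp_predictionError hg hlim
  have hz (m : ℕ) : ∫ u, errorOp κ δ f m u ∂μ = 0 := by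
    have := (errorOp κ δ f m).integral_comp_comm (IsGaussian.integrable_id (μ := μ))
    simpa [hμ.integral_eq_zero] using this
  have h1 : Tendsto (fun m => eLpNorm (fun u => errorOp κ δ f m u - predictionError g u) 1 μ)
      atTop (𝓝 0) :=
    tendsto_of_tendsto_of_tendsto_of_le_of_le tendsto_const_nhds
      (tendsto_eLpNorm_errorOp_sub hlim) (fun _ => zero_le) fun m =>
        eLpNorm_le_eLpNorm_of_exponent_le (by norm_num) ((hR m).sub he).aestronglyMeasurable
  have h2 := tendsto_integral_of_L1' (predictionError g) he.aestronglyMeasurable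
    (Eventually.of_forall fun m => (hR m).integrable (by norm_num)) h1
  simp only [hz] at h2
  exact tendsto_nhds_unique h2 tendsto_const_nhds

lemma IsKappaGaussian.indepFun_predictionError (hμ : IsKappaGaussian κ f μ) (hδ : 0 < δ)
    (h : δ * ‖gramOp κ f‖ < 2) (hg : Measurable g) (hlim : Tendsto (fun m => predictorDist μ
      (transformerPrediction κ (fun _ => δ) m f) g) atTop (𝓝 0)) :
    IndepFun (predictionError g) observed μ := by
  have := hμ.jointly_gaussian
  refine indepFun_of_tendsto_of_uncorrelated hμ.integral_eq_zero
    (hμ.memLp_predictionError hg hlim) (observedCLM X n)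
    (tendsto_eLpNorm_errorOp_sub hlim) fun v L => ?_
  obtain ⟨w, hw⟩ := exists_eq_innerComp (observedL2 X n)
    (L ∘L (PiLp.continuousLinearEquiv 2 ℝ fun _ : Fin n => X).toContinuousLinearMap)
  have hw' : L ∘L observedCLM X n = innerComp (observedL2 X n) w := hw
  rw [hw', ← featureMap_apply]
  -- The covariance of the error with `⟪w, observed⟫` is `⟪R ^ (m + 1) y, J w⟫ = ⟪J† R ^ (m + 1) y,
  -- w⟫`, a vanishing gradient.
  have h1 := tendsto_adjoint_residualOp_pow hδ (hμ.mul_norm_featureMap_sq_lt h)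
    (featureMap μ (lastCLM X n) v)
  have h2 := ((h1.comp (tendsto_add_atTop_nat 1)).inner (𝕜 := ℝ) (tendsto_const_nhds (x := w)))
  rw [inner_zero_left] at h2
  refine h2.congr fun m => ?_
  rw [Function.comp_apply, ContinuousLinearMap.adjoint_inner_left, hμ.featureMap_errorOp]

/-- The mean squared error is the irreducible error plus the distance to the optimal predictor. -/
lemma IsKappaGaussian.meanSquareError_eq_add (hμ : IsKappaGaussian κ f μ) (hδ : 0 < δ)
    (h : δ * ‖gramOp κ f‖ < 2) (hg : Measurable g) (hlim : Tendsto (fun m => predictorDist μ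
      (transformerPrediction κ (fun _ => δ) m f) g) atTop (𝓝 0))
    {g' : (Fin n → X) → X} (hg' : Measurable g') :
    meanSquareError μ g' = meanSquareError μ g + predictorDist μ g g' := by
  have := hμ.jointly_gaussian
  have key := lintegral_enorm_add_sq_of_indepFun (hμ.memLp_predictionError hg hlim)
    measurable_observed (hμ.indepFun_predictionError hδ h hg hlim)
    (hμ.integral_predictionError hg hlim) (hg.sub hg')
  simpa [predictionError, meanSquareError, predictorDist] using key

lemma IsKappaGaussian.isTheBLUPAndBayes (hμ : IsKappaGaussian κ f μ) (hδ : 0 < δ)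
    (h : δ * ‖gramOp κ f‖ < 2) (hg : Measurable g) (hlim : Tendsto (fun m => predictorDist μ
      (transformerPrediction κ (fun _ => δ) m f) g) atTop (𝓝 0)) :
    IsTheBLUPAndBayes μ g := by
  have := hμ.jointly_gaussian
  have hpyth {g' : (Fin n → X) → X} (hg' : Measurable g') :=
    hμ.meanSquareError_eq_add hδ h hg hlim hg'
  have he := hμ.memLp_predictionError hg hlim
  have hlin : IsLinearPredictor μ g := by
    refine ⟨hg, predictionOp κ δ f, ?_⟩
    refine hlim.congr fun m => ?_
    rw [predictorDist_comm, funext fun u => predictionOp_apply κ δ m f u]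
  have hlast : MemLp (fun u : Fin (n + 1) → X => u (Fin.last n)) 2 μ :=
    IsGaussian.memLp_two_id.continuousLinearMap_comp (lastCLM X n)
  have hgL : MemLp (fun u => g (observed u)) 2 μ := by
    convert hlast.sub he using 1
    ext u
    simp [predictionError]
  have hunb : IsUnbiased μ g := by
    refine ⟨hgL.integrable (by norm_num), hlast.integrable (by norm_num), ?_⟩
    have h0 := hμ.integral_predictionError hg hlim
    simp only [predictionError] at h0
    rw [integral_sub (hlast.integrable (by norm_num)) (hgL.integrable (by norm_num)),
      sub_eq_zero] at h0
    exact h0.symm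
  have hfin : meanSquareError μ g ≠ ∞ :=
    ((memLp_two_iff he.aestronglyMeasurable).1 he).ne
  have huniq {g' : (Fin n → X) → X} (hg' : Measurable g')
      (hle : meanSquareError μ g' ≤ meanSquareError μ g) :
      ∀ᵐ u ∂μ, g' (observed u) = g (observed u) := by
    refine ae_eq_of_predictorDist_eq_zero hg' hg ?_
    rw [hpyth hg', predictorDist_comm] at hle
    by_contra hne
    -- Finiteness of the irreducible error is what allows it to be cancelled.
    exact absurd (ENNReal.lt_add_right hfin hne) (not_lt.2 hle)
  refine ⟨⟨⟨hlin, hunb, fun g' hg' _ => ?_⟩, fun g' hg' => ?_⟩, ⟨hg, fun g' hg' => ?_⟩,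
    fun g' hg' => ?_⟩
  · rw [hpyth hg'.1]; exact le_self_add
  · exact huniq hg'.1.1 (hg'.2.2 g hlin hunb)
  · rw [hpyth hg']; exact le_self_add
  · exact huniq hg'.1 (hg'.2 g hg)

omit [CompleteSpace X] [SecondCountableTopology X] [MeasurableSpace X] [BorelSpace X] in
lemma mul_norm_lt_two_of_norm_one_sub_lt_one {A : Type*} [NormedAddCommGroup A] [NormedSpace ℝ A]
    {K : A →L[ℝ] A} (hδ : 0 < δ) (h : ‖1 - δ • K‖ < 1) : δ * ‖K‖ < 2 := by
  have h1 : ‖δ • K‖ = δ * ‖K‖ := by rw [norm_smul, Real.norm_of_nonneg hδ.le]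
  have h2 : ‖(1 : A →L[ℝ] A)‖ ≤ 1 := ContinuousLinearMap.norm_id_le
  have h3 := norm_sub_le (1 : A →L[ℝ] A) (1 - δ • K)
  rw [sub_sub_cancel] at h3
  linarith

omit [CompleteSpace X] in
lemma measurable_krigingPredictor : Measurable (krigingPredictor κ f) := by
  have : krigingPredictor κ f = (crossOp κ f ∘L Ring.inverse (gramOp κ f)) ∘L
    (PiLp.continuousLinearEquiv 2 ℝ fun _ : Fin n => X).symm.toContinuousLinearMap := rfl
  rw [this]
  fun_prop

/-- The abstract `L²`-limit is an almost sure limit along a subsequence, and the pointwise limit is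
already known from the Neumann series. -/
lemma IsKappaGaussian.tendsto_predictorDist_krigingPredictor (hμ : IsKappaGaussian κ f μ)
    (hδ : 0 < δ) (h : ‖1 - δ • gramOp κ f‖ < 1) :
    Tendsto (fun m => predictorDist μ (transformerPrediction κ (fun _ => δ) m f)
      (krigingPredictor κ f)) atTop (𝓝 0) := by
  obtain ⟨b, hb, hlim⟩ :=
    hμ.exists_tendsto_predictorDist hδ (mul_norm_lt_two_of_norm_one_sub_lt_one hδ h)
  have hmT (m : ℕ) : AEStronglyMeasurable
      (fun u => transformerPrediction κ (fun _ => δ) m f (observed u)) μ :=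
    ((measurable_transformerPrediction_right m).comp measurable_observed).aestronglyMeasurable
  have h1 : TendstoInMeasure μ
      (fun m u => transformerPrediction κ (fun _ => δ) m f (observed u)) atTop
      (fun u => b (observed u)) :=
    tendstoInMeasure_of_tendsto_eLpNorm (p := 2) (by norm_num) hmT
      (hb.comp measurable_observed).aestronglyMeasurable (tendsto_eLpNorm_two_iff.2 hlim)
  obtain ⟨ns, hns, hae⟩ := h1.exists_seq_tendsto_ae
  have heq : ∀ᵐ u ∂μ, b (observed u) = krigingPredictor κ f (observed u) := by
    filter_upwards [hae] with u hu
    exact tendsto_nhds_unique hu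
      ((tendsto_transformerPrediction κ f h (observed u)).comp hns.tendsto_atTop)
  refine hlim.congr fun m => lintegral_congr_ae ?_
  filter_upwards [heq] with u hu
  rw [hu]

end Optimality

/-! ### Disintegration of the in-context loss over the inputs. -/

section InContext

variable {X : Type*} [NormedAddCommGroup X] [InnerProductSpace ℝ X] {n : ℕ}
  [CompleteSpace X] [SecondCountableTopology X] [MeasurableSpace X] [BorelSpace X]
  {Ω : Type*} [MeasurableSpace Ω] {P : Measure Ω} [IsProbabilityMeasure P]
  {F U : Ω → Fin (n + 1) → X}

omit [InnerProductSpace ℝ X] in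
lemma inContextLoss_eq_lintegral (hF : Measurable F) (hU : Measurable U)
    {g : (Fin (n + 1) → X) → (Fin n → X) → X}
    (hg : AEMeasurable (fun p : (Fin (n + 1) → X) × (Fin (n + 1) → X) => g p.1 (observed p.2))
      (P.map fun ω => (F ω, U ω))) :
    inContextLoss P F U g =
      ∫⁻ f, meanSquareError (condDistrib U F P f) (g f) ∂(P.map F) := by
  have hm : AEMeasurable (fun p : (Fin (n + 1) → X) × (Fin (n + 1) → X) =>
      ‖p.2 (Fin.last n) - g p.1 (observed p.2)‖ₑ ^ 2) (P.map fun ω => (F ω, U ω)) :=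
    ((by fun_prop : AEMeasurable (fun p : (Fin (n + 1) → X) × (Fin (n + 1) → X) =>
      p.2 (Fin.last n)) _).sub hg).enorm.pow_const 2
  have h1 : inContextLoss P F U g = ∫⁻ p, ‖p.2 (Fin.last n) - g p.1 (observed p.2)‖ₑ ^ 2
      ∂(P.map fun ω => (F ω, U ω)) := by
    rw [lintegral_map' hm (by fun_prop)]; rfl
  rw [← compProd_map_condDistrib hU.aemeasurable] at h1 hm
  rw [Measure.compProd] at h1 hm
  rw [h1, Kernel.lintegral_compProd₀ _ _ _ hm, Kernel.const_apply]
  rfl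

omit [CompleteSpace X] in
lemma aemeasurable_of_measurable_uncurry {ν : Measure ((Fin (n + 1) → X) × (Fin (n + 1) → X))}
    {g : (Fin (n + 1) → X) → (Fin n → X) → X} (hg : Measurable (Function.uncurry g)) :
    AEMeasurable (fun p : (Fin (n + 1) → X) × (Fin (n + 1) → X) => g p.1 (observed p.2)) ν :=
  (hg.comp (measurable_fst.prodMk (measurable_observed.comp measurable_snd))).aemeasurable

end InContext
end ContinuumICL

end

open ContinuumICL in
theorem proposition1 {X : Type*} [NormedAddCommGroup X] [InnerProductSpace ℝ X] [CompleteSpace X]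
    [SecondCountableTopology X] [MeasurableSpace X] [BorelSpace X] (n : ℕ)
    (κ : X → X → X →L[ℝ] X) (hκ : ∀ v : X, Measurable fun p : X × X => κ p.1 p.2 v)
    {Ω : Type*} [MeasurableSpace Ω] (P : Measure Ω) [IsProbabilityMeasure P]
    (F U : Ω → Fin (n + 1) → X) (hF : Measurable F) (hU : Measurable U)
    (hUF : ∀ᵐ f ∂(P.map F), IsKappaGaussian κ f (condDistrib U F P f)) :
    -- Conditionally on the inputs: convergence to the kriging predictor by a Neumann series.
    (∀ᵐ f ∂(P.map F), ∀ δ : ℝ, 0 < δ → ‖1 - δ • gramOp κ f‖ < 1 →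
      IsUnit (gramOp κ f) ∧
      HasSum (fun k : ℕ => δ • (1 - δ • gramOp κ f) ^ k) (Ring.inverse (gramOp κ f)) ∧
      (∀ u : Fin n → X, Tendsto (fun m => transformerPrediction κ (fun _ => δ) m f u) atTop
        (𝓝 (krigingPredictor κ f u))) ∧
      IsTheBLUPAndBayes (condDistrib U F P f) (krigingPredictor κ f)) ∧
    -- The same in mean square when the Gram operator need not have a bounded inverse.
    (∀ᵐ f ∂(P.map F), ∀ δ : ℝ, 0 < δ → δ * ‖gramOp κ f‖ < 2 →
      ∃ b : (Fin n → X) → X, IsTheBLUPAndBayes (condDistrib U F P f) b ∧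
        Tendsto (fun m => predictorDist (condDistrib U F P f)
          (transformerPrediction κ (fun _ => δ) m f) b) atTop (𝓝 0)) ∧
    -- The limit minimizes the in-context loss, averaged over the inputs as well.
    (∀ δ : ℝ, 0 < δ → (∀ᵐ f ∂(P.map F), ‖1 - δ • gramOp κ f‖ < 1) →
      (∀ᵐ ω ∂P, Tendsto
        (fun m => transformerPrediction κ (fun _ => δ) m (F ω) (observed (U ω))) atTop
        (𝓝 (krigingPredictor κ (F ω) (observed (U ω))))) ∧
      AEMeasurable (fun ω => krigingPredictor κ (F ω) (observed (U ω))) P ∧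
      ∀ g : (Fin (n + 1) → X) → (Fin n → X) → X, Measurable (Function.uncurry g) →
        inContextLoss P F U (krigingPredictor κ) ≤ inContextLoss P F U g) ∧
    -- The in-context loss of the transformer tends to the minimal loss.
    (∀ δ : ℝ, 0 < δ → (∀ᵐ f ∂(P.map F), δ * ‖gramOp κ f‖ < 2) →
      ∫⁻ ω, ‖U ω (Fin.last n)‖ₑ ^ 2 ∂P < ∞ →
      Tendsto (fun m => inContextLoss P F U (transformerPrediction κ (fun _ => δ) m)) atTop
        (𝓝 (⨅ g : {g : (Fin (n + 1) → X) → (Fin n → X) → X // Measurable (Function.uncurry g)},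
          inContextLoss P F U g.1))) := by
  have hmT (δ : ℝ) (m : ℕ) := measurable_transformerPrediction (n := n) hκ δ m
  refine ⟨?_, ?_, fun δ hδ hlt => ?_, fun δ hδ hlt hfin => ?_⟩
  · filter_upwards [hUF] with f hμ δ hδ hlt
    obtain ⟨h1, h2⟩ := isUnit_and_hasSum_of_norm_one_sub_smul_lt_one (gramOp κ f) hlt
    exact ⟨h1, h2, tendsto_transformerPrediction κ f hlt,
      hμ.isTheBLUPAndBayes hδ (mul_norm_lt_two_of_norm_one_sub_lt_one hδ hlt)
        measurable_krigingPredictor (hμ.tendsto_predictorDist_krigingPredictor hδ hlt)⟩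
  · filter_upwards [hUF] with f hμ δ hδ hlt
    obtain ⟨b, hb, hlim⟩ := hμ.exists_tendsto_predictorDist hδ hlt
    exact ⟨b, hμ.isTheBLUPAndBayes hδ hlt hb hlim, hlim⟩
  · have hconv : ∀ᵐ f ∂(P.map F), ∀ u : Fin n → X,
        Tendsto (fun m => transformerPrediction κ (fun _ => δ) m f u) atTop
          (𝓝 (krigingPredictor κ f u)) := by
      filter_upwards [hlt] with f hf using tendsto_transformerPrediction κ f hf
    have hFU : Measurable fun ω => (F ω, U ω) := hF.prodMk hU
    have hconvω : ∀ᵐ ω ∂P, ∀ u : Fin n → X,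
        Tendsto (fun m => transformerPrediction κ (fun _ => δ) m (F ω) u) atTop
          (𝓝 (krigingPredictor κ (F ω) u)) := ae_of_ae_map hF.aemeasurable hconv
    have hconvp : ∀ᵐ p ∂(P.map fun ω => (F ω, U ω)),
        Tendsto (fun m => transformerPrediction κ (fun _ => δ) m p.1 (observed p.2)) atTop
          (𝓝 (krigingPredictor κ p.1 (observed p.2))) := by
      have h1 : (P.map fun ω => (F ω, U ω)).map Prod.fst = P.map F := by
        rw [Measure.map_map measurable_fst hFU]; rfl
      rw [← h1] at hconv
      filter_upwards [ae_of_ae_map measurable_fst.aemeasurable hconv] with p hp using hp _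
    -- Joint measurability of the kriging predictor in inputs and observations is obtained only
    -- almost everywhere, as a limit of transformer predictions; this avoids measurability of the
    -- operator inverse.
    have hkm := aemeasurable_of_tendsto_metrizable_ae' (fun m =>
      aemeasurable_of_measurable_uncurry (hmT δ m)) hconvp
    refine ⟨hconvω.mono fun ω h => h _, hkm.comp_aemeasurable hFU.aemeasurable,
      fun g hg => ?_⟩
    rw [inContextLoss_eq_lintegral hF hU hkm,
      inContextLoss_eq_lintegral hF hU (aemeasurable_of_measurable_uncurry hg)]
    refine lintegral_mono_ae ?_
    filter_upwards [hUF, hlt] with f hμ hf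
    exact (hμ.isTheBLUPAndBayes hδ (mul_norm_lt_two_of_norm_one_sub_lt_one hδ hf)
        measurable_krigingPredictor (hμ.tendsto_predictorDist_krigingPredictor hδ hf)).2.1.2 _
        (hg.comp measurable_prodMk_left)
  · have hb : ∀ᵐ f ∂(P.map F), ∃ V : ℝ≥0∞,
        Tendsto (fun m => meanSquareError (condDistrib U F P f)
          (transformerPrediction κ (fun _ => δ) m f)) atTop (𝓝 V) ∧
        ∀ g : (Fin n → X) → X, Measurable g → V ≤ meanSquareError (condDistrib U F P f) g := by
      filter_upwards [hUF, hlt] with f hμ hf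
      obtain ⟨b, hb, hlim⟩ := hμ.exists_tendsto_predictorDist hδ hf
      refine ⟨meanSquareError (condDistrib U F P f) b, ?_,
        (hμ.isTheBLUPAndBayes hδ hf hb hlim).2.1.2⟩
      simp_rw [fun m => hμ.meanSquareError_eq_add hδ hf hb hlim
        (measurable_transformerPrediction_right (κ := κ) (δ := δ) (f := f) m),
        predictorDist_comm b]
      simpa using hlim.const_add (meanSquareError (condDistrib U F P f) b)
    have hL (m : ℕ) := inContextLoss_eq_lintegral (P := P) hF hU
      (aemeasurable_of_measurable_uncurry (hmT δ m))
    have := Measure.isProbabilityMeasure_map (μ := P) hF.aemeasurable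
    -- `V f` is the minimal conditional error; no optimal predictor jointly measurable in `f` is
    -- selected.
    obtain ⟨V, hV⟩ := hb.choice
    have hL0 := inContextLoss_eq_lintegral (P := P) hF hU
      (g := fun _ _ => (0 : X)) aemeasurable_const
    have htend : Tendsto (fun m => inContextLoss P F U (transformerPrediction κ (fun _ => δ) m))
        atTop (𝓝 (∫⁻ f, V f ∂(P.map F))) := by
      simp_rw [hL]
      -- The zero predictor dominates every depth, and its loss is the assumed second moment.
      refine tendsto_lintegral_of_dominated_convergence'
        (fun f => meanSquareError (condDistrib U F P f) fun _ => 0) (fun m => ?_) (fun m => ?_) ?_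
        (hV.mono fun f h => h.1)
      · refine (Measurable.lintegral_kernel_prod_right' (κ := condDistrib U F P)
          (f := fun p : (Fin (n + 1) → X) × (Fin (n + 1) → X) => ‖p.2 (Fin.last n) -
            transformerPrediction κ (fun _ => δ) m p.1 (observed p.2)‖ₑ ^ 2) ?_).aemeasurable
        have h1 : Measurable fun p : (Fin (n + 1) → X) × (Fin (n + 1) → X) =>
            transformerPrediction κ (fun _ => δ) m p.1 (observed p.2) :=
          (hmT δ m).comp (measurable_fst.prodMk (measurable_observed.comp measurable_snd))
        exact (((measurable_pi_apply _).comp measurable_snd).sub h1).enorm.pow_const 2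
      · filter_upwards [hUF, hlt] with f hμ hf
        simpa [meanSquareError] using hμ.meanSquareError_transformerPrediction_le hδ hf m
      · rw [← hL0]
        simpa [inContextLoss] using hfin.ne
    have hinf : ⨅ g : {g : (Fin (n + 1) → X) → (Fin n → X) → X // Measurable (Function.uncurry g)},
        inContextLoss P F U g.1 = ∫⁻ f, V f ∂(P.map F) := by
      -- The transformers are themselves admissible predictors, so the infimum is at most their
      -- limiting loss; the converse is the conditional lower bound, integrated.
      refine le_antisymm (ge_of_tendsto' htend fun m => iInf_le_of_le ⟨_, hmT δ m⟩ le_rfl)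
        (le_iInf fun g => ?_)
      rw [inContextLoss_eq_lintegral hF hU (aemeasurable_of_measurable_uncurry g.2)]
      refine lintegral_mono_ae ?_
      filter_upwards [hV] with f hf using hf.2 _ (g.2.comp measurable_prodMk_left)
    rw [hinf]
    exact htend
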